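/- Let $G=(V,E)$ be a simple graph, finite or infinite (of any cardinality), with no isolated edge, i.e. every edge of $G$ shares an endvertex with some other edge of $G$. Let $k$ be a natural number and let $L$ assign to every vertex $v\in V$ a list $L_v\subseteq\{1,\dots,k\}$ with exactly one element and to every edge $e\in E$ a list $L_e\subseteq\{1,\dots,k\}$ with at least five elements. Then there is a function $\omega$ on $V\cup E$ with $\omega(v)\in L_v$ for every $v\in V$ and $\omega(e)\in L_e$ for every $e\in E$ such that, for every edge $uv\in E$, either $s_\omega(u)\neq s_\omega(v)$, or $u$ and $v$ have the same infinite degree. Here $s_\omega(v)=\omega(v)+\sum_{w\in N(v)}\omega(vw)$ is the weighted degree of $v$; degrees and weighted degrees are cardinal numbers. -/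

import Mathlib

namespace TotalWeighting

universe u

variable {V : Type u}

/-- The edge `e` of `G` is isolated: it has no endvertex in common with any other edge of `G`. -/
def IsIsolatedEdge (G : SimpleGraph V) (e : Sym2 V) : Prop :=
  e ∈ G.edgeSet ∧ ∀ f ∈ G.edgeSet, f ≠ e → ∀ v ∈ e, v ∉ f

/-- A set of lists for `G` with weights in `{1, …, k}`: a list (a set of admissible weights)
for every vertex and for every edge of `G`. -/
structure Lists (G : SimpleGraph V) (k : ℕ) where
  /-- the list of a vertex -/
  vert : V → Finset ℕ
  /-- the list of an edge -/
  edge : G.edgeSet → Finset ℕ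
  vert_subset : ∀ v, vert v ⊆ Finset.Icc 1 k
  edge_subset : ∀ e, edge e ⊆ Finset.Icc 1 k

/-- A function `ω` on `V ∪ E` with values in the natural numbers. -/
structure Weighting (G : SimpleGraph V) where
  /-- the weight of a vertex -/
  vert : V → ℕ
  /-- the weight of an edge -/
  edge : G.edgeSet → ℕ

/-- `ω` is a weighting of `G` from the set of lists `L`. -/
def Weighting.IsFrom {G : SimpleGraph V} {k : ℕ} (ω : Weighting G) (L : Lists G k) : Prop :=
  (∀ v, ω.vert v ∈ L.vert v) ∧ ∀ e, ω.edge e ∈ L.edge e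

/-- The degree of a vertex, as a cardinal number. -/
noncomputable def degree (G : SimpleGraph V) (v : V) : Cardinal.{u} :=
  Cardinal.mk (G.neighborSet v)

/-- The weighted degree of `v`, as a cardinal number: the sum of the weights of the edges `vw`
over all neighbours `w` of `v`, plus the weight of `v` itself. -/
noncomputable def Weighting.weightedDegree {G : SimpleGraph V} (ω : Weighting G) (v : V) :
    Cardinal.{u} :=
  Cardinal.sum (fun w : G.neighborSet v => (ω.edge ⟨s(v, (w : V)), w.2⟩ : Cardinal.{u}))
    + (ω.vert v : Cardinal.{u})

/-- `G` has an `L`-weighting: there is a weighting from the lists `L` such that the endvertices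
of each edge have different weighted degrees, or both have the same infinite degree. -/
def HasWeighting (G : SimpleGraph V) {k : ℕ} (L : Lists G k) : Prop :=
  ∃ ω : Weighting G, ω.IsFrom L ∧ ∀ u v : V, G.Adj u v →
    ω.weightedDegree u ≠ ω.weightedDegree v ∨
      (degree G u = degree G v ∧ Cardinal.aleph0 ≤ degree G u)

end TotalWeighting

/-!
Only edges between two vertices of finite degree are in question: a vertex of infinite degree has its
degree as weighted degree. By compactness of the product of the finite edge lists
(`exists_weights_of_finite_degree`) it suffices to satisfy finitely many edges at a time, and these
live in a finite graph without isolated edges. The vertex weights are constants `c` there.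

For a finite graph, let `Y_v` be the sum of the edge variables at `v`. By the Combinatorial
Nullstellensatz it suffices to find in `∏ (Y_u - Y_v)`, the product over all edges, a monomial with
exponents at most `4` and nonzero coefficient (`exists_weights_of_coeff_ne_zero`). The pairing
`⟨f, g⟩ = ∑ K! f_K g_K` has the property that substituting linear forms is adjoint to substituting
the transposed forms (`pairing_aeval_linear`). Hence, for a product `Θ` of linear forms in the edge
variables that contains no variable more than four times, such a monomial exists as soon as
`⟨∏ (x_u - x_v) · m, Θ'⟩ ≠ 0`, where `m` is a monomial and `Θ'` arises from `Θ` by replacing each edge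
by the sum of its two ends; the factor `m` does no harm because passing to a divisor of a monomial
keeps its exponents small.

The forms are built from an independent set `B` of maximum weight, leaves being slightly heavier than
other vertices (`exists_dominating_indep`), placed at the end of a linear order of the vertices. For
`w` outside `B`, the differences of consecutive edges from `w` to later neighbours become differences
`x_v - x_v'` of consecutive later neighbours. Those with `v` outside `B` reproduce the part of
`∏ (x_u - x_v)` outside `B`, in the sense that only one monomial of extreme weight contributes to the
pairing. All other forms become `x_b ± x_b'` with `b, b'` in `B` and are squared; their product `g` is
self-reciprocal, so the central coefficient of `g ^ 2` is, up to sign, a sum of squares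
(`IsSelfReciprocal.coeff_sq_ne_zero`). This makes the pairing nonzero provided that these forms cover
every edge at `B` (`Tokens.exists_coeff_ne_zero`).

The chains cover the edges from the vertices `w` with at least two neighbours in `B`. The private
vertices, those with just one neighbour in `B`, need additional forms. They get pointers to
neighbours outside `B`, which are paired up as far as possible (`exists_pairedPointers`); a pair of
pointers to `y`, or an unpaired pointer to `y`, gives a form in which the vertices outside `B`
cancel. The parities are such that all private vertices are covered and no edge variable is used more
than four times (`Layout.usage_le`). The tight case is a private vertex that is the target of two
unpaired pointers: its only edge to `B` is used four times already and must not occur in its chain,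
so it has to come after all its neighbours outside `B`. These vertices form an independent set, which
makes such an order possible.
-/

namespace TotalWeighting

open MvPolynomial

/-! ### The factorial pairing of polynomials -/

section Pairing

variable {σ τ : Type*}

/-- The pairing `⟨f, g⟩ = ∑ K, K! f_K g_K` of integer polynomials, where `K!` is the product of the
factorials of the exponents. Multiplication by `X i` is adjoint to `∂/∂X i` for it. -/
noncomputable def pairing (f g : MvPolynomial σ ℤ) : ℤ :=
  ∑ K ∈ f.support, (K.prod fun _ n => (n.factorial : ℤ)) * coeff K f * coeff K g

theorem pairing_eq_sum (f g : MvPolynomial σ ℤ) {s : Finset (σ →₀ ℕ)} (hs : f.support ⊆ s) :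
    pairing f g = ∑ K ∈ s, (K.prod fun _ n => (n.factorial : ℤ)) * coeff K f * coeff K g := by
  refine Finset.sum_subset hs fun K _ hK => ?_
  rw [notMem_support_iff.mp hK]; ring

theorem pairing_add_left (f₁ f₂ g : MvPolynomial σ ℤ) :
    pairing (f₁ + f₂) g = pairing f₁ g + pairing f₂ g := by
  classical
  rw [pairing_eq_sum (f₁ + f₂) g support_add,
    pairing_eq_sum f₁ g (Finset.subset_union_left (s₂ := f₂.support)),
    pairing_eq_sum f₂ g (Finset.subset_union_right (s₁ := f₁.support)), ← Finset.sum_add_distrib]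
  refine Finset.sum_congr rfl fun K _ => ?_
  rw [coeff_add]; ring

theorem pairing_add_right (f g₁ g₂ : MvPolynomial σ ℤ) :
    pairing f (g₁ + g₂) = pairing f g₁ + pairing f g₂ := by
  simp only [pairing, ← Finset.sum_add_distrib, coeff_add, mul_add]

theorem pairing_C_mul_left (a : ℤ) (f g : MvPolynomial σ ℤ) :
    pairing (C a * f) g = a * pairing f g := by
  have h : (C a * f).support ⊆ f.support := by
    intro K
    simp only [mem_support_iff, coeff_C_mul]
    exact right_ne_zero_of_mul
  rw [pairing_eq_sum _ g h, pairing, Finset.mul_sum]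
  refine Finset.sum_congr rfl fun K _ => ?_
  rw [coeff_C_mul]; ring

theorem pairing_C_mul_right (a : ℤ) (f g : MvPolynomial σ ℤ) :
    pairing f (C a * g) = a * pairing f g := by
  rw [pairing, pairing, Finset.mul_sum]
  refine Finset.sum_congr rfl fun K _ => ?_
  rw [coeff_C_mul]; ring

theorem pairing_zero_left (g : MvPolynomial σ ℤ) : pairing 0 g = 0 := by simp [pairing]

theorem pairing_zero_right (f : MvPolynomial σ ℤ) : pairing f 0 = 0 := by simp [pairing]

theorem pairing_sum_left {ι : Type*} (s : Finset ι) (f : ι → MvPolynomial σ ℤ)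
    (g : MvPolynomial σ ℤ) : pairing (∑ i ∈ s, f i) g = ∑ i ∈ s, pairing (f i) g := by
  classical
  induction s using Finset.induction_on with
  | empty => simp [pairing_zero_left]
  | insert i s hi ih => rw [Finset.sum_insert hi, Finset.sum_insert hi, pairing_add_left, ih]

theorem pairing_sum_right {ι : Type*} (s : Finset ι) (f : MvPolynomial σ ℤ)
    (g : ι → MvPolynomial σ ℤ) : pairing f (∑ i ∈ s, g i) = ∑ i ∈ s, pairing f (g i) := by
  classical
  induction s using Finset.induction_on with
  | empty => simp [pairing_zero_right]
  | insert i s hi ih => rw [Finset.sum_insert hi, Finset.sum_insert hi, pairing_add_right, ih]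

theorem pairing_monomial (K : σ →₀ ℕ) (a : ℤ) (g : MvPolynomial σ ℤ) :
    pairing (monomial K a) g = (K.prod fun _ n => (n.factorial : ℤ)) * a * coeff K g := by
  classical
  rw [pairing_eq_sum _ g (s := {K}) support_monomial_subset, Finset.sum_singleton,
    coeff_monomial, if_pos rfl]

theorem prod_factorial_add_single (K : σ →₀ ℕ) (i : σ) :
    ((K + Finsupp.single i 1).prod fun _ n => (n.factorial : ℤ))
      = (K i + 1 : ℤ) * K.prod fun _ n => (n.factorial : ℤ) := by
  classical
  set s := insert i K.support
  have h0 : ∀ j ∈ s, ((Nat.factorial 0 : ℕ) : ℤ) = 1 := by simp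
  have hs : (K + Finsupp.single i 1).support ⊆ s := by
    intro j hj
    by_cases h : j = i
    · simp [s, h]
    · simp only [Finsupp.mem_support_iff, Finsupp.add_apply, ne_eq] at hj
      rw [Finsupp.single_eq_of_ne h] at hj
      simp [s, h] at hj ⊢
      exact hj
  rw [Finsupp.prod_of_support_subset _ hs _ h0,
    Finsupp.prod_of_support_subset K (Finset.subset_insert _ _) _ h0,
    ← Finset.mul_prod_erase s _ (Finset.mem_insert_self _ _),
    ← Finset.mul_prod_erase s (fun j => ((K j).factorial : ℤ)) (Finset.mem_insert_self _ _)]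
  have : ∏ x ∈ s.erase i, (((K + Finsupp.single i 1 : σ →₀ ℕ) x).factorial : ℤ)
      = ∏ x ∈ s.erase i, ((K x).factorial : ℤ) := by
    refine Finset.prod_congr rfl fun x hx => ?_
    rw [Finsupp.add_apply, Finsupp.single_eq_of_ne (Finset.ne_of_mem_erase hx), add_zero]
  rw [this]
  simp [Nat.factorial_succ]
  ring

theorem pairing_mul_X (f g : MvPolynomial σ ℤ) (i : σ) :
    pairing (f * X i) g = pairing f (pderiv i g) := by
  classical
  induction f using MvPolynomial.induction_on' with
  | monomial K a =>
    rw [X, monomial_mul, pairing_monomial, pairing_monomial, mul_one, coeff_pderiv,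
      prod_factorial_add_single]
    ring
  | add f₁ f₂ h₁ h₂ => rw [add_mul, pairing_add_left, pairing_add_left, h₁, h₂]

/-- Substituting linear forms is adjoint, for the factorial pairing, to substituting the linear
forms with the transposed matrix. -/
theorem pairing_aeval_linear [Fintype σ] [Fintype τ] (c : τ → σ → ℤ)
    (f : MvPolynomial τ ℤ) (g : MvPolynomial σ ℤ) :
    pairing (aeval (fun v => ∑ e, C (c v e) * X e) f) g
      = pairing f (aeval (fun e => ∑ v, (C (c v e) * X v : MvPolynomial τ ℤ)) g) := by
  classical
  -- the chain rule for the transposed substitution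
  have chain : ∀ (v : τ) (h : MvPolynomial σ ℤ),
      pderiv v (aeval (fun e => ∑ v, (C (c v e) * X v : MvPolynomial τ ℤ)) h)
        = aeval (fun e => ∑ v, (C (c v e) * X v : MvPolynomial τ ℤ))
            (∑ e, C (c v e) * pderiv e h) := by
    intro v h
    induction h using MvPolynomial.induction_on with
    | C a => simp
    | add h₁ h₂ ih₁ ih₂ =>
      simp only [map_add, ih₁, ih₂, mul_add, Finset.sum_add_distrib]
    | mul_X h e ih =>
      rw [map_mul, pderiv_mul, ih]
      simp only [map_sum, map_mul, pderiv_mul, aeval_X, mul_add, Finset.sum_add_distrib,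
        pderiv_X, pderiv_C, zero_mul, zero_add, map_add, algHom_C]
      congr 1
      · rw [Finset.sum_mul]
        refine Finset.sum_congr rfl fun x _ => ?_
        simp [mul_assoc]
      · simp only [Pi.single_apply]
        simp [Finset.sum_ite_eq, mul_comm]
  induction f using MvPolynomial.induction_on generalizing g with
  | C a =>
    rw [algHom_C]
    change pairing (monomial 0 a) g = pairing (monomial 0 a) _
    rw [pairing_monomial, pairing_monomial]
    congr 1
    rw [← constantCoeff_eq, ← constantCoeff_eq]
    induction g using MvPolynomial.induction_on with
    | C a => simp
    | add h₁ h₂ ih₁ ih₂ => simp only [map_add, ih₁, ih₂]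
    | mul_X h e ih => simp
  | add f₁ f₂ h₁ h₂ => rw [map_add, pairing_add_left, pairing_add_left, h₁, h₂]
  | mul_X f v ih =>
    rw [map_mul, aeval_X, pairing_mul_X, chain, ← ih, Finset.mul_sum, pairing_sum_left,
      pairing_sum_right]
    refine Finset.sum_congr rfl fun e _ => ?_
    rw [← mul_assoc, mul_comm _ (C _), mul_assoc, pairing_C_mul_left, pairing_C_mul_right,
      pairing_mul_X]

end Pairing

/-! ### Extreme monomials and self-reciprocal polynomials -/

section Lead

variable {σ : Type*}

/-- For the weight function `wt` on the variables, `X ^ η` occurs in `f` with coefficient `1`, and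
all other monomials of `f` have strictly larger weight. -/
def HasLowest (wt : σ → ℤ) (f : MvPolynomial σ ℤ) (η : σ →₀ ℕ) : Prop :=
  coeff η f = 1 ∧ ∀ K ∈ f.support, K ≠ η → Finsupp.weight wt η < Finsupp.weight wt K

theorem HasLowest.le {wt : σ → ℤ} {f : MvPolynomial σ ℤ} {η : σ →₀ ℕ} (h : HasLowest wt f η)
    {K : σ →₀ ℕ} (hK : K ∈ f.support) : Finsupp.weight wt η ≤ Finsupp.weight wt K := by
  by_cases hKη : K = η
  · rw [hKη]
  · exact (h.2 K hK hKη).le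

theorem HasLowest.coeff_add_mul {wt : σ → ℤ} {f g : MvPolynomial σ ℤ} {η d : σ →₀ ℕ}
    (h : HasLowest wt f η) (hg : ∀ K ∈ g.support, Finsupp.weight wt d ≤ Finsupp.weight wt K) :
    coeff (η + d) (f * g) = coeff d g := by
  classical
  rw [coeff_mul, Finset.sum_eq_single (η, d)]
  · simp [h.1]
  · rintro ⟨K₁, K₂⟩ hK hne
    by_contra h0
    have h1 : K₁ ∈ f.support := mem_support_iff.mpr (left_ne_zero_of_mul h0)
    have h2 : K₂ ∈ g.support := mem_support_iff.mpr (right_ne_zero_of_mul h0)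
    rw [Finset.HasAntidiagonal.mem_antidiagonal] at hK
    dsimp only at hK h1 h2
    have hw := congrArg (Finsupp.weight wt) hK
    rw [map_add, map_add] at hw
    have hK1 : K₁ = η := by
      by_contra hn
      have := h.2 K₁ h1 hn
      have := hg K₂ h2
      omega
    subst hK1
    exact hne (by rw [add_left_cancel hK])
  · intro hn
    refine absurd ?_ hn
    rw [Finset.HasAntidiagonal.mem_antidiagonal]

theorem HasLowest.mul {wt : σ → ℤ} {f g : MvPolynomial σ ℤ} {η d : σ →₀ ℕ}
    (hf : HasLowest wt f η) (hg : HasLowest wt g d) : HasLowest wt (f * g) (η + d) := by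
  classical
  refine ⟨by rw [hf.coeff_add_mul fun K hK => hg.le hK, hg.1], fun K hK hne => ?_⟩
  obtain ⟨K₁, h1, K₂, h2, rfl⟩ := Finset.mem_add.mp (support_mul f g hK)
  have hle1 := hf.le h1
  have hle2 := hg.le h2
  rw [map_add, map_add]
  by_cases hK1 : K₁ = η
  · have hK2 : K₂ ≠ d := fun h => hne (by rw [hK1, h])
    have := hg.2 K₂ h2 hK2
    omega
  · have := hf.2 K₁ h1 hK1
    omega

theorem HasLowest.one (wt : σ → ℤ) : HasLowest wt (1 : MvPolynomial σ ℤ) 0 := by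
  classical
  refine ⟨by simp, fun K hK hne => ?_⟩
  rw [mem_support_iff, coeff_one, if_neg (Ne.symm hne)] at hK
  exact absurd rfl hK

theorem HasLowest.prod {ι : Type*} {wt : σ → ℤ} (s : Finset ι) {f : ι → MvPolynomial σ ℤ}
    {η : ι → σ →₀ ℕ} (h : ∀ i ∈ s, HasLowest wt (f i) (η i)) :
    HasLowest wt (∏ i ∈ s, f i) (∑ i ∈ s, η i) := by
  classical
  induction s using Finset.induction_on with
  | empty => simpa using HasLowest.one wt
  | insert i s hi ih =>
    rw [Finset.prod_insert hi, Finset.sum_insert hi]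
    exact (h i (by simp)).mul (ih fun j hj => h j (by simp [hj]))

theorem HasLowest.X_sub_X {wt : σ → ℤ} {i j : σ} (h : wt i < wt j) :
    HasLowest wt (X i - X j : MvPolynomial σ ℤ) (Finsupp.single i 1) := by
  classical
  have hij : j ≠ i := fun h' => by rw [h'] at h; exact lt_irrefl _ h
  have hs : Finsupp.single j 1 ≠ Finsupp.single i 1 := fun h' =>
    hij (Finsupp.single_left_injective one_ne_zero h')
  refine ⟨by simp [coeff_X, hs], fun K hK hne => ?_⟩
  rw [mem_support_iff, coeff_sub, coeff_X, coeff_X, if_neg (Ne.symm hne)] at hK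
  by_cases hK' : Finsupp.single j 1 = K
  · rw [← hK']; simpa [Finsupp.weight_apply] using h
  · simp [hK'] at hK

theorem HasLowest.monomial (wt : σ → ℤ) (t : σ →₀ ℕ) :
    HasLowest wt (monomial t (1 : ℤ)) t := by
  classical
  refine ⟨by simp, fun K hK hne => ?_⟩
  rw [mem_support_iff, coeff_monomial, if_neg (Ne.symm hne)] at hK
  exact absurd rfl hK

/-- The coefficients of `g` at exponents `η`, `η'` with `η + η' = d` agree up to the common sign
`s`, and `g` has no other exponents than the `η ≤ d`. -/
structure IsSelfReciprocal (g : MvPolynomial σ ℤ) (d : σ →₀ ℕ) (s : ℤ) : Prop where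
  sq_eq_one : s * s = 1
  le_of_mem : ∀ K ∈ g.support, K ≤ d
  coeff_eq : ∀ η η' : σ →₀ ℕ, η + η' = d → coeff η g = s * coeff η' g

theorem IsSelfReciprocal.one : IsSelfReciprocal (1 : MvPolynomial σ ℤ) 0 1 := by
  classical
  refine ⟨rfl, fun K hK => ?_, fun η η' h => ?_⟩
  · rw [mem_support_iff, coeff_one] at hK
    by_cases h : 0 = K
    · exact h ▸ le_rfl
    · simp [h] at hK
  · rw [add_eq_zero] at h
    simp [h.1, h.2]

theorem IsSelfReciprocal.mul {g h : MvPolynomial σ ℤ} {d₁ d₂ : σ →₀ ℕ} {s₁ s₂ : ℤ}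
    (hg : IsSelfReciprocal g d₁ s₁) (hh : IsSelfReciprocal h d₂ s₂) :
    IsSelfReciprocal (g * h) (d₁ + d₂) (s₁ * s₂) := by
  classical
  refine ⟨?_, fun K hK => ?_, fun η η' hη => ?_⟩
  · linear_combination s₂ * s₂ * hg.sq_eq_one + hh.sq_eq_one
  · obtain ⟨K₁, h1, K₂, h2, rfl⟩ := Finset.mem_add.mp (support_mul g h hK)
    exact add_le_add (hg.le_of_mem _ h1) (hh.le_of_mem _ h2)
  · have le1 : ∀ K, coeff K g ≠ 0 → K ≤ d₁ := fun K hK => hg.le_of_mem K (mem_support_iff.mpr hK)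
    have le2 : ∀ K, coeff K h ≠ 0 → K ≤ d₂ := fun K hK => hh.le_of_mem K (mem_support_iff.mpr hK)
    have e1 : ∀ K, K ≤ d₁ → coeff K g = s₁ * coeff (d₁ - K) g := fun K hK =>
      hg.coeff_eq _ _ (add_tsub_cancel_of_le hK)
    have e2 : ∀ K, K ≤ d₂ → coeff K h = s₂ * coeff (d₂ - K) h := fun K hK =>
      hh.coeff_eq _ _ (add_tsub_cancel_of_le hK)
    have key : ∀ (η η' : σ →₀ ℕ), η + η' = d₁ + d₂ → ∀ a ∈ Finset.HasAntidiagonal.antidiagonal η,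
        coeff a.1 g * coeff a.2 h ≠ 0 → (d₁ - a.1, d₂ - a.2) ∈ Finset.HasAntidiagonal.antidiagonal η' := by
      intro η η' hη a ha h0
      have l1 := le1 _ (left_ne_zero_of_mul h0)
      have l2 := le2 _ (right_ne_zero_of_mul h0)
      rw [Finset.HasAntidiagonal.mem_antidiagonal] at ha ⊢
      ext x
      have := DFunLike.congr_fun hη x
      have := DFunLike.congr_fun ha x
      have := l1 x
      have := l2 x
      simp only [Finsupp.add_apply, Finsupp.tsub_apply] at *
      omega
    have val : ∀ a : (σ →₀ ℕ) × (σ →₀ ℕ), coeff a.1 g * coeff a.2 h ≠ 0 →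
        coeff a.1 g * coeff a.2 h
          = s₁ * s₂ * (coeff (d₁ - a.1) g * coeff (d₂ - a.2) h) := by
      intro a h0
      rw [e1 _ (le1 _ (left_ne_zero_of_mul h0)), e2 _ (le2 _ (right_ne_zero_of_mul h0))]
      ring
    have inv : ∀ a : (σ →₀ ℕ) × (σ →₀ ℕ), coeff a.1 g * coeff a.2 h ≠ 0 →
        (d₁ - (d₁ - a.1), d₂ - (d₂ - a.2)) = a := by
      intro a h0
      rw [tsub_tsub_cancel_of_le (le1 _ (left_ne_zero_of_mul h0)),
        tsub_tsub_cancel_of_le (le2 _ (right_ne_zero_of_mul h0))]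
    have ne : ∀ a : (σ →₀ ℕ) × (σ →₀ ℕ), coeff a.1 g * coeff a.2 h ≠ 0 →
        s₁ * s₂ * (coeff (d₁ - a.1) g * coeff (d₂ - a.2) h) ≠ 0 := by
      intro a h0
      rw [← val a h0]
      exact h0
    rw [coeff_mul, coeff_mul, Finset.mul_sum]
    refine Finset.sum_bij_ne_zero (fun a _ _ => (d₁ - a.1, d₂ - a.2))
      (fun a ha h0 => key η η' hη a ha h0) (fun a ha h0 b hb h0' hab => ?_)
      (fun b hb h0 => ?_) (fun a ha h0 => val a h0)
    · rw [← inv a h0, ← inv b h0']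
      simp only [Prod.mk.injEq] at hab
      rw [hab.1, hab.2]
    · have h0' := right_ne_zero_of_mul h0
      exact ⟨(d₁ - b.1, d₂ - b.2), key η' η (by rw [add_comm]; exact hη) b hb h0',
        right_ne_zero_of_mul (ne b h0'), inv b h0'⟩

theorem IsSelfReciprocal.X_add_X (i j : σ) {ε : ℤ} (hε : ε * ε = 1) :
    IsSelfReciprocal (X i + C ε * X j) (Finsupp.single i 1 + Finsupp.single j 1) ε := by
  classical
  have hc : ∀ K, coeff K (X i + C ε * X j : MvPolynomial σ ℤ)
      = (if Finsupp.single i 1 = K then 1 else 0)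
        + ε * (if Finsupp.single j 1 = K then 1 else 0) := by
    intro K; rw [coeff_add, coeff_C_mul, coeff_X, coeff_X]
  refine ⟨hε, fun K hK => ?_, fun η η' h => ?_⟩
  · rw [mem_support_iff, hc] at hK
    by_cases h1 : Finsupp.single i 1 = K
    · rw [← h1]; exact le_self_add
    · by_cases h2 : Finsupp.single j 1 = K
      · rw [← h2]; exact le_add_self
      · simp [h1, h2] at hK
  · have h1 : Finsupp.single i 1 = η ↔ Finsupp.single j 1 = η' := by
      constructor
      · rintro rfl; exact (add_left_cancel h).symm
      · rintro rfl; exact (add_right_cancel h).symm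
    have h2 : Finsupp.single j 1 = η ↔ Finsupp.single i 1 = η' := by
      rw [add_comm (Finsupp.single i 1)] at h
      constructor
      · rintro rfl; exact (add_left_cancel h).symm
      · rintro rfl; exact (add_right_cancel h).symm
    rw [hc, hc]
    simp only [h1, h2]
    linear_combination -(if Finsupp.single j 1 = η' then 1 else 0) * hε

theorem IsSelfReciprocal.prod {ι : Type*} (t : Finset ι) {g : ι → MvPolynomial σ ℤ}
    {d : ι → σ →₀ ℕ} {s : ι → ℤ} (h : ∀ i ∈ t, IsSelfReciprocal (g i) (d i) (s i)) :
    IsSelfReciprocal (∏ i ∈ t, g i) (∑ i ∈ t, d i) (∏ i ∈ t, s i) := by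
  classical
  induction t using Finset.induction_on with
  | empty => simpa using IsSelfReciprocal.one
  | insert i t hi ih =>
    rw [Finset.prod_insert hi, Finset.sum_insert hi, Finset.prod_insert hi]
    exact (h i (by simp)).mul (ih fun j hj => h j (by simp [hj]))

/-- The central coefficient of the square of a self-reciprocal polynomial is, up to sign, the sum of
the squares of its coefficients. -/
theorem IsSelfReciprocal.coeff_sq_ne_zero {g : MvPolynomial σ ℤ} {d : σ →₀ ℕ} {s : ℤ}
    (h : IsSelfReciprocal g d s) (hg : g ≠ 0) : coeff d (g ^ 2) ≠ 0 := by
  classical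
  have hs : s ≠ 0 := fun h0 => by simpa [h0] using h.sq_eq_one
  obtain ⟨K, hK⟩ := ne_zero_iff.mp hg
  have hle := h.le_of_mem K (mem_support_iff.mpr hK)
  have : coeff d (g ^ 2) = s * ∑ a ∈ Finset.HasAntidiagonal.antidiagonal d, coeff a.2 g ^ 2 := by
    rw [sq, coeff_mul, Finset.mul_sum]
    refine Finset.sum_congr rfl fun a ha => ?_
    rw [h.coeff_eq a.1 a.2 (Finset.HasAntidiagonal.mem_antidiagonal.mp ha)]
    ring
  rw [this]
  refine mul_ne_zero hs (ne_of_gt ?_)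
  refine Finset.sum_pos' (fun a _ => sq_nonneg _) ⟨(d - K, K), ?_, by positivity⟩
  rw [Finset.HasAntidiagonal.mem_antidiagonal]
  exact tsub_add_cancel_of_le hle

/-- If the lowest monomial `X ^ η` of `g` for `wt` is the highest one of `f`, in the sense that it
is the lowest for `-wt`, then only this monomial contributes to the pairing. -/
theorem pairing_ne_zero {wt : σ → ℤ} {f g : MvPolynomial σ ℤ} {η : σ →₀ ℕ}
    (hf : HasLowest (fun i => -wt i) f η) (hη : coeff η g ≠ 0)
    (hg : ∀ K ∈ g.support, Finsupp.weight wt η ≤ Finsupp.weight wt K) : pairing f g ≠ 0 := by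
  have hneg : ∀ K : σ →₀ ℕ, Finsupp.weight (fun i => -wt i) K = -Finsupp.weight wt K := by
    intro K
    simp [Finsupp.weight_apply, Finsupp.sum]
  rw [pairing, Finset.sum_eq_single η]
  · rw [hf.1, mul_one]
    refine mul_ne_zero (Finset.prod_ne_zero_iff.mpr fun i _ => ?_) hη
    exact Nat.cast_ne_zero.mpr (Nat.factorial_ne_zero _)
  · intro K hK hne
    have h1 := hf.2 K hK hne
    rw [hneg, hneg] at h1
    have h2 : K ∉ g.support := fun h => by have := hg K h; omega
    rw [notMem_support_iff.mp h2, mul_zero]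
  · intro hn
    rw [notMem_support_iff.mp hn]
    ring

end Lead

/-! ### A monomial with small exponents in the graph polynomial -/

section GraphPolynomial

variable {V : Type*} [Fintype V] [LinearOrder V]

/-- The `v`-`e` entry of the incidence matrix of `G`. Columns of non-edges are zero. -/
noncomputable def incidence (G : SimpleGraph V) (v : V) (e : Sym2 V) : ℤ :=
  open Classical in if v ∈ e ∧ e ∈ G.edgeSet then 1 else 0

/-- The sum of the edge variables at `v`. -/
noncomputable def starSum (G : SimpleGraph V) (v : V) : MvPolynomial (Sym2 V) ℤ :=
  ∑ e, C (incidence G v e) * X e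

/-- The sum of the vertex variables of the two ends of `e`. -/
noncomputable def endSum (G : SimpleGraph V) (e : Sym2 V) : MvPolynomial V ℤ :=
  ∑ v, C (incidence G v e) * X v

theorem endSum_mk {G : SimpleGraph V} {a b : V} (h : G.Adj a b) :
    endSum G s(a, b) = X a + X b := by
  classical
  have hne := h.ne
  rw [endSum, ← Finset.sum_subset (Finset.subset_univ {a, b}), Finset.sum_pair hne]
  · simp [incidence, h]
  · intro v _ hv
    simp only [Finset.mem_insert, Finset.mem_singleton] at hv
    simp [incidence, hv]

/-- The edges of `G`, each written as the pair (higher end, lower end). -/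
noncomputable def orientedEdges (G : SimpleGraph V) : Finset (V × V) :=
  open Classical in {p | G.Adj p.1 p.2 ∧ p.2 < p.1}

theorem mem_orientedEdges {G : SimpleGraph V} {p : V × V} :
    p ∈ orientedEdges G ↔ G.Adj p.1 p.2 ∧ p.2 < p.1 := by
  simp [orientedEdges]

/-- The data of linear forms in the edge variables that produce a monomial of the graph polynomial.
The set `B` is a final segment of the order and independent. Each edge `(v, w)` with higher end
`v ∉ B` has a successor `succ (v, w)`, a later neighbour of `w`; it gives the form `e_{wv} - e_{wv'}`,
`v'` the successor. In addition there are forms `form j`, to be used twice, which become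
`x_b ± x_b'` with `b, b' ∈ B` when an edge is replaced by the sum of its ends. The two ends of `form
j` are ascribed to the vertices `owner (j, _)`, so that every edge at a vertex of `B` is covered;
and no edge variable is used more than four times. -/
structure Tokens (G : SimpleGraph V) (B : Set V) (J : Type*) [Fintype J] where
  lt_of_mem : ∀ a ∉ B, ∀ b ∈ B, a < b
  indep : ∀ a ∈ B, ∀ b ∈ B, ¬ G.Adj a b
  succ : V × V → V
  lt_succ : ∀ p ∈ orientedEdges G, p.1 ∉ B → p.1 < succ p
  adj_succ : ∀ p ∈ orientedEdges G, p.1 ∉ B → G.Adj p.2 (succ p)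
  form : J → MvPolynomial (Sym2 V) ℤ
  label : J × Bool → V
  sign : J → ℤ
  label_mem : ∀ i, label i ∈ B
  sign_sq : ∀ j, sign j * sign j = 1
  sign_eq : ∀ j, label (j, false) = label (j, true) → sign j = 1
  aeval_form : ∀ j, aeval (endSum G) (form j)
    = X (label (j, false)) + C (sign j) * X (label (j, true))
  owner : J × Bool → V
  cover : ∀ b ∈ B, ∀ w, G.Adj b w → ∃ i, label i = b ∧ owner i = w
  uses : J → Sym2 V → Prop
  degreeOf_le : ∀ j e, degreeOf e (form j) ≤ open Classical in if uses j e then 1 else 0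
  usage_le : ∀ e, open Classical in
    (orientedEdges G |>.filter fun p => p.1 ∉ B ∧ (e = s(p.2, p.1) ∨ e = s(p.2, succ p))).card
      + 2 * (Finset.univ.filter fun j => uses j e).card ≤ 4

theorem degreeOf_X_le {σ : Type*} {e a : σ} {Q : Prop} [Decidable Q] (h : e = a → Q) :
    degreeOf e (X a : MvPolynomial σ ℤ) ≤ if Q then 1 else 0 := by
  classical
  rw [degreeOf_X]
  split_ifs with h1 h2
  · exact le_rfl
  · exact absurd (h h1) h2
  · exact Nat.zero_le _
  · exact le_rfl

theorem degreeOf_add_le_of_le {σ : Type*} {e : σ} {f g : MvPolynomial σ ℤ} {n : ℕ}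
    (hf : degreeOf e f ≤ n) (hg : degreeOf e g ≤ n) : degreeOf e (f + g) ≤ n :=
  (degreeOf_add_le _ _ _).trans (max_le hf hg)

theorem degreeOf_sub_le_of_le {σ : Type*} {e : σ} {f g : MvPolynomial σ ℤ} {n : ℕ}
    (hf : degreeOf e f ≤ n) (hg : degreeOf e g ≤ n) : degreeOf e (f - g) ≤ n :=
  (degreeOf_sub_le _ _ _).trans (max_le hf hg)

theorem Tokens.exists_coeff_ne_zero {G : SimpleGraph V} {B : Set V} {J : Type*} [Fintype J]
    (T : Tokens G B J) :
    ∃ K : Sym2 V →₀ ℕ,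
      coeff K (∏ p ∈ orientedEdges G, (starSum G p.1 - starSum G p.2)) ≠ 0 ∧ ∀ e, K e ≤ 4 := by
  classical
  set D := orientedEdges G with hD
  set DA := D.filter (fun p => p.1 ∉ B) with hDA
  set DB := D.filter (fun p => ¬ p.1 ∉ B) with hDB
  have low : ∀ p ∈ D, p.2 ∉ B := by
    intro p hp h2
    have hp' := mem_orientedEdges.mp hp
    by_cases h1 : p.1 ∈ B
    · exact T.indep _ h1 _ h2 hp'.1
    · exact absurd (T.lt_of_mem _ h1 _ h2) (not_lt.mpr hp'.2.le)
  -- a weight that increases along the order outside `B`, and is constant on `B`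
  set wt : V → ℤ := fun v => if v ∈ B then (Fintype.card V : ℤ)
    else ((Finset.univ.filter (· < v)).card : ℤ) with hwt
  have wt_lt : ∀ u v : V, u < v → u ∉ B → wt u < wt v := by
    intro u v huv hu
    have hu' : wt u = ((Finset.univ.filter (· < u)).card : ℤ) := by simp [hwt, hu]
    rw [hu']
    by_cases hv : v ∈ B
    · have : wt v = Fintype.card V := by simp [hwt, hv]
      rw [this]
      have : (Finset.univ.filter (· < u)).card < (Finset.univ : Finset V).card :=
        Finset.card_lt_card (Finset.filter_ssubset.mpr ⟨u, by simp, by simp⟩)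
      rw [Finset.card_univ] at this
      exact_mod_cast this
    · have : wt v = ((Finset.univ.filter (· < v)).card : ℤ) := by simp [hwt, hv]
      rw [this]
      have : (Finset.univ.filter (· < u)).card < (Finset.univ.filter (· < v)).card := by
        refine Finset.card_lt_card ⟨fun x hx => ?_, fun h => ?_⟩
        · simp only [Finset.mem_filter, Finset.mem_univ, true_and] at hx ⊢
          exact hx.trans huv
        · have : u ∈ Finset.univ.filter (· < u) := h (by simp [huv])
          simp at this
      exact_mod_cast this
  -- `R` and `g` are the images of the two kinds of forms; `δ` collects the degrees on `B`, and `d`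
  -- counts the ends of forms at the vertices of `B`
  set R : MvPolynomial V ℤ := ∏ p ∈ DA, (X p.1 - X (T.succ p)) with hR
  set g : MvPolynomial V ℤ :=
    ∏ j, (X (T.label (j, false)) + C (T.sign j) * X (T.label (j, true))) with hg
  set ηA : V →₀ ℕ := ∑ p ∈ DA, Finsupp.single p.1 1 with hηA
  set δ : V →₀ ℕ := ∑ p ∈ DB, Finsupp.single p.1 1 with hδ
  set d : V →₀ ℕ := ∑ j, (Finsupp.single (T.label (j, false)) 1
    + Finsupp.single (T.label (j, true)) 1) with hd
  have hRlow : HasLowest wt R ηA := by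
    refine HasLowest.prod _ fun p hp => HasLowest.X_sub_X ?_
    rw [hDA, Finset.mem_filter] at hp
    exact wt_lt _ _ (T.lt_succ p hp.1 hp.2) hp.2
  have hgrec : IsSelfReciprocal g d (∏ j, T.sign j) :=
    IsSelfReciprocal.prod _ fun j _ => IsSelfReciprocal.X_add_X _ _ (T.sign_sq j)
  have hg0 : g ≠ 0 := by
    refine Finset.prod_ne_zero_iff.mpr fun j _ h => ?_
    have h1 := congrArg (coeff (Finsupp.single (T.label (j, false)) 1)) h
    rw [coeff_add, coeff_C_mul, coeff_X, coeff_X, if_pos rfl, coeff_zero] at h1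
    by_cases h2 : T.label (j, false) = T.label (j, true)
    · rw [T.sign_eq j h2, h2] at h1
      simp at h1
    · rw [if_neg fun h' => h2 (Finsupp.single_left_injective one_ne_zero h').symm] at h1
      simp at h1
  have wtB : ∀ i, wt (T.label i) = Fintype.card V := fun i => by simp [hwt, T.label_mem i]
  have hghom : IsWeightedHomogeneous wt g (∑ _j : J, (Fintype.card V : ℤ)) := by
    refine IsWeightedHomogeneous.prod _ _ _ fun j _ => ?_
    refine Submodule.add_mem (weightedHomogeneousSubmodule ℤ wt _) ?_ ?_
    · rw [mem_weightedHomogeneousSubmodule, ← wtB (j, false)]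
      exact isWeightedHomogeneous_X _ _ _
    · rw [mem_weightedHomogeneousSubmodule, ← zero_add (Fintype.card V : ℤ), ← wtB (j, true)]
      exact (isWeightedHomogeneous_C _ _).mul (isWeightedHomogeneous_X _ _ _)
  have hdw : Finsupp.weight wt d = 2 • ∑ _j : J, (Fintype.card V : ℤ) := by
    rw [hd, map_sum, two_nsmul, ← Finset.sum_add_distrib]
    refine Finset.sum_congr rfl fun j _ => ?_
    rw [map_add, Finsupp.weight_single, Finsupp.weight_single, wtB, wtB, one_smul]
  have hg2 : ∀ K ∈ (g ^ 2).support, Finsupp.weight wt d ≤ Finsupp.weight wt K := by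
    intro K hK
    rw [hghom.pow 2 (mem_support_iff.mp hK), hdw]
  -- the transposed substitution turns the product of the forms into `R * g ^ 2`
  set Θ : MvPolynomial (Sym2 V) ℤ :=
    (∏ p ∈ DA, (X s(p.2, p.1) - X s(p.2, T.succ p))) * (∏ j, T.form j) ^ 2 with hΘ
  have hΘR : aeval (endSum G) Θ = R * g ^ 2 := by
    rw [hΘ, map_mul, map_pow, map_prod, map_prod, hR, hg]
    congr 1
    · refine Finset.prod_congr rfl fun p hp => ?_
      rw [hDA, Finset.mem_filter] at hp
      rw [map_sub, aeval_X, aeval_X, endSum_mk (mem_orientedEdges.mp hp.1).1.symm,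
        endSum_mk (T.adj_succ p hp.1 hp.2)]
      ring
    · congr 1
      exact Finset.prod_congr rfl fun j _ => T.aeval_form j
  have hδd : δ ≤ d := by
    intro b
    have h1 : δ b = (DB.filter (fun p => p.1 = b)).card := by
      rw [hδ, Finsupp.finsetSum_apply, Finset.card_filter]
      exact Finset.sum_congr rfl fun p _ => by rw [Finsupp.single_apply]
    have h2 : d b = (Finset.univ.filter (fun i : J × Bool => T.label i = b)).card := by
      rw [hd, Finsupp.finsetSum_apply, Finset.card_filter, Fintype.sum_prod_type]
      refine Finset.sum_congr rfl fun j _ => ?_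
      rw [Fintype.sum_bool, Finsupp.add_apply, Finsupp.single_apply, Finsupp.single_apply,
        add_comm]
    rw [h1, h2]
    refine Finset.card_le_card_of_surjOn (fun i => (b, T.owner i)) ?_
    rintro ⟨x, w⟩ hp
    simp only [hDB, Finset.coe_filter, Finset.mem_filter, Set.mem_ofPred_eq, not_not] at hp
    obtain ⟨⟨hp, hxB⟩, rfl⟩ := hp
    obtain ⟨i, hi, rfl⟩ := T.cover x hxB w (mem_orientedEdges.mp hp).1
    exact ⟨i, by simp [hi], rfl⟩
  -- the extra monomial raises the exponents in `B` from the degrees `δ` to `d`, so that the highest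
  -- monomial of `P` is the one known to occur in `R * g ^ 2`
  set P : MvPolynomial V ℤ := (∏ p ∈ D, (X p.1 - X p.2)) * monomial (d - δ) 1 with hP
  have hPlow : HasLowest (fun v => -wt v) P (ηA + d) := by
    have h1 : HasLowest (fun v => -wt v) (∏ p ∈ D, (X p.1 - X p.2) : MvPolynomial V ℤ)
        (∑ p ∈ D, Finsupp.single p.1 1) := by
      refine HasLowest.prod _ fun p hp => HasLowest.X_sub_X ?_
      have := wt_lt _ _ (mem_orientedEdges.mp hp).2 (low p hp)
      omega
    have h2 := h1.mul (HasLowest.monomial (fun v => -wt v) (d - δ))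
    rwa [← Finset.sum_filter_add_sum_filter_not D (fun p => p.1 ∉ B), ← hDA, ← hDB, ← hηA, ← hδ,
      add_assoc, add_tsub_cancel_of_le hδd] at h2
  have hpair : pairing P (aeval (endSum G) Θ) ≠ 0 := by
    rw [hΘR]
    refine pairing_ne_zero hPlow ?_ fun K hK => ?_
    · rw [hRlow.coeff_add_mul hg2]
      exact hgrec.coeff_sq_ne_zero hg0
    · obtain ⟨K₁, h1, K₂, h2, rfl⟩ := Finset.mem_add.mp (support_mul _ _ hK)
      rw [map_add, map_add]
      exact add_le_add (hRlow.le h1) (hg2 _ h2)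
  have hadj := pairing_aeval_linear (incidence G) P Θ
  change pairing (aeval (starSum G) P) Θ = pairing P (aeval (endSum G) Θ) at hadj
  rw [← hadj, pairing] at hpair
  obtain ⟨K, hK, hK0⟩ := Finset.exists_ne_zero_of_sum_ne_zero hpair
  have hKΘ : K ∈ Θ.support := mem_support_iff.mpr (right_ne_zero_of_mul hK0)
  rw [hP, map_mul, map_prod] at hK
  obtain ⟨K₁, h1, K₂, h2, rfl⟩ := Finset.mem_add.mp (support_mul _ _ hK)
  refine ⟨K₁, ?_, fun e => ?_⟩
  · simpa only [map_sub, aeval_X] using mem_support_iff.mp h1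
  · calc K₁ e ≤ (K₁ + K₂) e := by simp
      _ ≤ degreeOf e Θ := monomial_le_degreeOf e hKΘ
      _ ≤ 4 := ?_
    refine le_trans ?_ (T.usage_le e)
    refine (degreeOf_mul_le _ _ _).trans (add_le_add ?_ ?_)
    · refine (degreeOf_prod_le _ _ _).trans ?_
      rw [← Finset.filter_filter, ← hDA, Finset.card_filter]
      refine Finset.sum_le_sum fun p _ => degreeOf_sub_le_of_le ?_ ?_
      · exact degreeOf_X_le Or.inl
      · exact degreeOf_X_le Or.inr
    · refine (degreeOf_pow_le _ _ _).trans (Nat.mul_le_mul_left 2 ?_)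
      rw [Finset.card_filter]
      exact (degreeOf_prod_le _ _ _).trans (Finset.sum_le_sum fun j _ => T.degreeOf_le j e)

/-- Lower order terms in the factors of a product of linear forms do not change the coefficients of
top degree. -/
theorem coeff_prod_add_C {σ ι : Type*} (s : Finset ι) (l : ι → MvPolynomial σ ℤ) (c : ι → ℤ)
    (hl : ∀ i ∈ s, (l i).IsHomogeneous 1) (K : σ →₀ ℕ) (hK : s.card ≤ K.degree) :
    coeff K (∏ i ∈ s, (l i + C (c i))) = coeff K (∏ i ∈ s, l i) := by
  classical
  induction s using Finset.induction_on generalizing K with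
  | empty => simp
  | insert i s hi ih =>
    have hls : ∀ j ∈ s, (l j).IsHomogeneous 1 := fun j hj => hl j (by simp [hj])
    rw [Finset.card_insert_of_notMem hi] at hK
    rw [Finset.prod_insert hi, Finset.prod_insert hi, add_mul, coeff_add, coeff_C_mul,
      ih hls K (by omega)]
    have hhom : (∏ j ∈ s, l j).IsHomogeneous s.card := by
      simpa using IsHomogeneous.prod s l (fun _ => 1) hls
    rw [hhom.coeff_eq_zero (by omega), mul_zero, add_zero, coeff_mul, coeff_mul]
    refine Finset.sum_congr rfl fun a ha => ?_
    by_cases h0 : coeff a.1 (l i) = 0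
    · simp [h0]
    · have h1 : a.1.degree = 1 := by
        by_contra h1
        exact h0 ((hl i (by simp)).coeff_eq_zero h1)
      rw [Finset.HasAntidiagonal.mem_antidiagonal] at ha
      have h2 := congrArg Finsupp.degree ha
      rw [map_add, h1] at h2
      rw [ih hls a.2 (by omega)]

theorem isHomogeneous_starSum (G : SimpleGraph V) (v : V) : (starSum G v).IsHomogeneous 1 := by
  refine IsHomogeneous.sum _ _ _ fun e _ => ?_
  rw [← zero_add 1]
  exact (isHomogeneous_C _ _).mul (isHomogeneous_X _ _)

theorem eval_starSum (G : SimpleGraph V) (v : V) (ω : Sym2 V → ℤ) :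
    eval ω (starSum G v) = open Classical in
      ∑ w, if G.Adj v w then ω s(v, w) else 0 := by
  classical
  rw [starSum, map_sum, ← Finset.sum_filter]
  simp only [incidence, map_mul, eval_C, eval_X, ite_mul, one_mul, zero_mul]
  rw [← Finset.sum_filter]
  symm
  refine Finset.sum_bij (fun w _ => s(v, w)) (fun w hw => ?_) (fun w _ w' _ h => ?_)
    (fun e he => ?_) (fun _ _ => rfl)
  · simpa using hw
  · exact Sym2.congr_right.mp h
  · induction e with | h a b =>
    simp only [Finset.mem_filter, Finset.mem_univ, true_and, Sym2.mem_iff,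
      SimpleGraph.mem_edgeSet] at he
    obtain ⟨rfl | rfl, h⟩ := he
    · exact ⟨b, by simpa using h, rfl⟩
    · exact ⟨a, by simpa using h.symm, Sym2.eq_swap⟩

/-- The Combinatorial Nullstellensatz turns a monomial with exponents at most `4` of the graph
polynomial into a choice of weights from lists of size `5`. -/
theorem exists_weights_of_coeff_ne_zero (G : SimpleGraph V) {K : Sym2 V →₀ ℕ}
    (hK : coeff K (∏ p ∈ orientedEdges G, (starSum G p.1 - starSum G p.2)) ≠ 0)
    (hK4 : ∀ e, K e ≤ 4) (c : V → ℤ) (L : Sym2 V → Finset ℤ) (hL : ∀ e, 5 ≤ (L e).card) :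
    ∃ ω : Sym2 V → ℤ, (∀ e, ω e ∈ L e) ∧ ∀ u v, G.Adj u v →
      eval ω (starSum G u) + c u ≠ eval ω (starSum G v) + c v := by
  classical
  set D := orientedEdges G with hD
  have hhom : ∀ p ∈ D, (starSum G p.1 - starSum G p.2).IsHomogeneous 1 := fun p _ =>
    (isHomogeneous_starSum G _).sub (isHomogeneous_starSum G _)
  have hhom' : (∏ p ∈ D, (starSum G p.1 - starSum G p.2)).IsHomogeneous D.card := by
    simpa using IsHomogeneous.prod D _ (fun _ => 1) hhom
  have hdeg : K.degree = D.card := by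
    by_contra h
    exact hK (hhom'.coeff_eq_zero h)
  set f : MvPolynomial (Sym2 V) ℤ :=
    ∏ p ∈ D, (starSum G p.1 - starSum G p.2 + C (c p.1 - c p.2)) with hf
  have hfK : coeff K f ≠ 0 := by
    rw [hf, coeff_prod_add_C D _ _ hhom K hdeg.ge]
    exact hK
  have htot : f.totalDegree = K.degree := by
    refine le_antisymm ?_ ?_
    · rw [hdeg, hf]
      refine (totalDegree_finsetProd _ _).trans ?_
      rw [Finset.card_eq_sum_ones]
      refine Finset.sum_le_sum fun p hp => ?_
      refine (totalDegree_add _ _).trans (max_le (hhom p hp).totalDegree_le ?_)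
      rw [totalDegree_C]
      exact Nat.zero_le _
    · exact le_totalDegree (mem_support_iff.mpr hfK)
  obtain ⟨ω, hω, h0⟩ := combinatorial_nullstellensatz_exists_eval_nonzero f K hfK htot L
    fun e => lt_of_le_of_lt (hK4 e) (hL e)
  refine ⟨ω, hω, ?_⟩
  have main : ∀ u v, G.Adj u v → v < u →
      eval ω (starSum G u) + c u ≠ eval ω (starSum G v) + c v := by
    intro u v huv hlt h
    rw [hf, map_prod, Finset.prod_ne_zero_iff] at h0
    refine h0 (u, v) (mem_orientedEdges.mpr ⟨huv, hlt⟩) ?_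
    rw [map_add, map_sub, eval_C]
    linear_combination h
  intro u v huv
  rcases lt_trichotomy u v with h | h | h
  · exact (main v u huv.symm h).symm
  · exact absurd h huv.ne
  · exact main u v huv h

end GraphPolynomial

/-! ### Pointer configurations -/

section Pointers

variable {V : Type*} [Fintype V]

open Classical in
/-- The vertices whose pointer is `y`. -/
noncomputable def pointersTo (p : V → Option V) (y : V) : Finset V := {w | p w = some y}

theorem mem_pointersTo {p : V → Option V} {y w : V} : w ∈ pointersTo p y ↔ p w = some y := by
  simp [pointersTo]

/-- Some vertices satisfying `Q` point to a neighbour, and the target of a pointer, if it satisfies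
`Q`, has no pointer: the pointers form stars. -/
def IsStarPointer (H : SimpleGraph V) (Q : V → Prop) (p : V → Option V) : Prop :=
  ∀ w y, p w = some y → H.Adj w y ∧ Q w ∧ (Q y → p y = none)

open Classical in
/-- The vertices satisfying `Q` that neither have a pointer nor are the target of one. -/
noncomputable def idle (Q : V → Prop) (p : V → Option V) : Finset V :=
  {y | Q y ∧ p y = none ∧ ∀ u, p u ≠ some y}

theorem mem_idle {Q : V → Prop} {p : V → Option V} {y : V} :
    y ∈ idle Q p ↔ Q y ∧ p y = none ∧ ∀ u, p u ≠ some y := by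
  simp [idle]

open Classical in
theorem IsStarPointer.update {H : SimpleGraph V} {Q : V → Prop} {p : V → Option V}
    (hp : IsStarPointer H Q p) {y v : V} (hy : y ∈ idle Q p) (hyv : H.Adj y v)
    (hv : Q v → p v = none) :
    ∃ p', IsStarPointer H Q p' ∧ idle Q p' ⊆ (idle Q p).erase y := by
  obtain ⟨hQ, hpy, hu⟩ := mem_idle.mp hy
  refine ⟨Function.update p y (some v), fun w x h => ?_, fun z hz => ?_⟩
  · by_cases hw : w = y
    · subst hw
      rw [Function.update_self, Option.some_inj] at h
      subst h
      exact ⟨hyv, hQ, fun h => by rw [Function.update_of_ne hyv.ne']; exact hv h⟩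
    · rw [Function.update_of_ne hw] at h
      obtain ⟨h1, h2, h3⟩ := hp w x h
      refine ⟨h1, h2, fun hx => ?_⟩
      rw [Function.update_of_ne (fun hxy => hu w (by rw [h, hxy]))]
      exact h3 hx
  · obtain ⟨hQz, hpz, hz'⟩ := mem_idle.mp hz
    have hzy : z ≠ y := fun h => by simp [h] at hpz
    rw [Function.update_of_ne hzy] at hpz
    refine Finset.mem_erase.mpr ⟨hzy, mem_idle.mpr ⟨hQz, hpz, fun u hpu => ?_⟩⟩
    have huy : u ≠ y := fun h => by rw [h, hpy] at hpu; exact absurd hpu (by simp)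
    exact hz' u (by rw [Function.update_of_ne huy]; exact hpu)

/-- If no vertex satisfying `Q` is isolated, there are pointers forming stars, such that every vertex
satisfying `Q` has a pointer or is the target of one. -/
theorem exists_isStarPointer (H : SimpleGraph V) (Q : V → Prop) (hQ : ∀ w, Q w → ∃ v, H.Adj w v) :
    ∃ p, IsStarPointer H Q p ∧ idle Q p = ∅ := by
  classical
  suffices h : ∀ n (p : V → Option V), IsStarPointer H Q p → (idle Q p).card = n →
      ∃ p, IsStarPointer H Q p ∧ idle Q p = ∅ from
    h _ (fun _ => none) (fun w y h => by simp at h) rfl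
  intro n
  induction n using Nat.strong_induction_on with
  | _ n ih =>
  intro p hp hn
  by_cases hempty : idle Q p = ∅
  · exact ⟨p, hp, hempty⟩
  obtain ⟨y, hy⟩ := Finset.nonempty_iff_ne_empty.mpr hempty
  obtain ⟨hQy, hpy, hu⟩ := mem_idle.mp hy
  have hlt : ((idle Q p).erase y).card < n := hn ▸ Finset.card_erase_lt_of_mem hy
  have step : ∀ p', IsStarPointer H Q p' → idle Q p' ⊆ (idle Q p).erase y →
      ∃ p, IsStarPointer H Q p ∧ idle Q p = ∅ := fun p' h1 h2 =>
    ih _ (lt_of_le_of_lt (Finset.card_le_card h2) hlt) p' h1 rfl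
  obtain ⟨v, hyv⟩ := hQ y hQy
  by_cases hv : Q v → p v = none
  · obtain ⟨p', h1, h2⟩ := hp.update hy hyv hv
    exact step p' h1 h2
  -- `v` points to some `z`: let `y` point to `v` instead, and mend `z` if `v` was all it had
  push Not at hv
  obtain ⟨hQv, hv⟩ := hv
  obtain ⟨z, hz⟩ := Option.ne_none_iff_exists'.mp hv
  obtain ⟨hvz, -, hzQ⟩ := hp v z hz
  have hnov : ∀ u, p u ≠ some v := fun u h => hv ((hp u v h).2.2 hQv)
  set p₁ := Function.update (Function.update p v none) y (some v) with hp₁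
  have hp₁v : p₁ v = none := by simp [hp₁, hyv.ne']
  have hp₁o : ∀ w, w ≠ y → w ≠ v → p₁ w = p w := fun w h1 h2 => by simp [hp₁, h1, h2]
  have hp₁y : p₁ y = some v := by simp [hp₁]
  have hstar : IsStarPointer H Q p₁ := by
    intro w x h
    by_cases hwy : w = y
    · subst hwy
      rw [hp₁y, Option.some_inj] at h
      subst h
      exact ⟨hyv, hQy, fun _ => hp₁v⟩
    · by_cases hwv : w = v
      · rw [hwv, hp₁v] at h
        exact absurd h (by simp)
      rw [hp₁o w hwy hwv] at h
      obtain ⟨h1, h2, h3⟩ := hp w x h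
      refine ⟨h1, h2, fun hx => ?_⟩
      rw [hp₁o x (fun hxy => hu w (hxy ▸ h)) (fun hxv => hnov w (hxv ▸ h))]
      exact h3 hx
  have hsub : ∀ x ∈ idle Q p₁, x ≠ z → x ∈ (idle Q p).erase y := by
    intro x hx hxz
    obtain ⟨h1, h2, h3⟩ := mem_idle.mp hx
    have hxy : x ≠ y := fun h => by rw [h, hp₁y] at h2; simp at h2
    have hxv : x ≠ v := fun h => h3 y (by rw [hp₁y, h])
    rw [hp₁o x hxy hxv] at h2
    refine Finset.mem_erase.mpr ⟨hxy, mem_idle.mpr ⟨h1, h2, fun u hpu => ?_⟩⟩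
    have huy : u ≠ y := fun h => by rw [h, hpy] at hpu; simp at hpu
    have huv : u ≠ v := fun h => hxz (by rw [h, hz, Option.some_inj] at hpu; exact hpu.symm)
    exact h3 u (by rw [hp₁o u huy huv, hpu])
  by_cases hz₁ : z ∈ idle Q p₁
  · obtain ⟨p', h1, h2⟩ := hstar.update hz₁ hvz.symm (fun _ => hp₁v)
    refine step p' h1 fun x hx => ?_
    have := Finset.mem_erase.mp (h2 hx)
    exact hsub x this.2 this.1
  · exact step p₁ hstar fun x hx => hsub x hx fun h => hz₁ (h ▸ hx)

/-- Pointers from some of the vertices satisfying `Q` to neighbours, such that: the other vertices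
satisfying `Q` are targets; those which have a pointer are targets an even number of times; no two
vertices point to each other. -/
structure IsPointer (H : SimpleGraph V) (Q : V → Prop) (p : V → Option V) : Prop where
  adj : ∀ w y, p w = some y → H.Adj w y
  dom : ∀ w y, p w = some y → Q w
  exists_pointer : ∀ y, Q y → p y = none → ∃ u, p u = some y
  even : ∀ y, Q y → p y ≠ none → Even (pointersTo p y).card
  asymm : ∀ w y, p w = some y → p y ≠ some w

/-- A vertex satisfying `Q` without a pointer that is the target of an even number of pointers. -/
def IsEvenCenter (Q : V → Prop) (p : V → Option V) (y : V) : Prop :=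
  Q y ∧ p y = none ∧ Even (pointersTo p y).card

/-- Pointers with the fewest even centers have no two adjacent even centers: otherwise let one of
the two point to the other. -/
theorem exists_isPointer (H : SimpleGraph V) (Q : V → Prop) (hQ : ∀ w, Q w → ∃ v, H.Adj w v) :
    ∃ p, IsPointer H Q p ∧
      ∀ y₁ y₂, IsEvenCenter Q p y₁ → IsEvenCenter Q p y₂ → ¬ H.Adj y₁ y₂ := by
  classical
  suffices h : ∀ n (p : V → Option V), IsPointer H Q p →
      (Finset.univ.filter (IsEvenCenter Q p)).card = n → ∃ p, IsPointer H Q p ∧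
      ∀ y₁ y₂, IsEvenCenter Q p y₁ → IsEvenCenter Q p y₂ → ¬ H.Adj y₁ y₂ by
    obtain ⟨p, hp, hidle⟩ := exists_isStarPointer H Q hQ
    refine h _ p ⟨fun w y hw => (hp w y hw).1, fun w y hw => (hp w y hw).2.1, fun y hy hpy => ?_,
      fun y hy hpy => ?_, fun w y hw hy => ?_⟩ rfl
    · by_contra! hn
      have : y ∈ idle Q p := mem_idle.mpr ⟨hy, hpy, hn⟩
      simp [hidle] at this
    · have : pointersTo p y = ∅ := by
        refine Finset.eq_empty_of_forall_notMem fun w hw => ?_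
        exact hpy ((hp w y (mem_pointersTo.mp hw)).2.2 hy)
      simp [this]
    · have := (hp w y hw).2.2 (hp y w hy).2.1
      rw [this] at hy
      simp at hy
  intro n
  induction n using Nat.strong_induction_on with
  | _ n ih =>
  intro p hp hn
  by_cases hgood : ∀ y₁ y₂, IsEvenCenter Q p y₁ → IsEvenCenter Q p y₂ → ¬ H.Adj y₁ y₂
  · exact ⟨p, hp, hgood⟩
  push Not at hgood
  obtain ⟨a, b, ha, hb, hab⟩ := hgood
  set p' := Function.update p a (some b) with hp'
  have hp'a : p' a = some b := by simp [hp']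
  have hp'o : ∀ w, w ≠ a → p' w = p w := fun w h => by simp [hp', h]
  have hpt : ∀ y, y ≠ b → pointersTo p' y = pointersTo p y := by
    intro y hy
    ext w
    rw [mem_pointersTo, mem_pointersTo]
    by_cases hw : w = a
    · rw [hw, hp'a, ha.2.1]
      simp [Ne.symm hy]
    · rw [hp'o w hw]
  have hptb : pointersTo p' b = insert a (pointersTo p b) := by
    ext w
    rw [Finset.mem_insert, mem_pointersTo, mem_pointersTo]
    by_cases hw : w = a
    · simp [hw, hp'a]
    · simp [hw, hp'o w hw]
  have hodd : ¬ Even (pointersTo p' b).card := by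
    rw [hptb, Finset.card_insert_of_notMem (by simp [mem_pointersTo, ha.2.1]), Nat.even_add_one,
      not_not]
    exact hb.2.2
  have hp'b : p' b = none := by rw [hp'o b hab.ne', hb.2.1]
  have hpointer : IsPointer H Q p' := by
    refine ⟨fun w y hw => ?_, fun w y hw => ?_, fun y hy hpy => ?_, fun y hy hpy => ?_,
      fun w y hw hy => ?_⟩
    · by_cases hwa : w = a
      · rw [hwa, hp'a, Option.some_inj] at hw
        rw [hwa, ← hw]
        exact hab
      · exact hp.adj w y (by rwa [hp'o w hwa] at hw)
    · by_cases hwa : w = a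
      · rw [hwa]
        exact ha.1
      · exact hp.dom w y (by rwa [hp'o w hwa] at hw)
    · have hya : y ≠ a := fun h => by rw [h, hp'a] at hpy; simp at hpy
      rw [hp'o y hya] at hpy
      obtain ⟨u, hu⟩ := hp.exists_pointer y hy hpy
      have hua : u ≠ a := fun h => by rw [h, ha.2.1] at hu; simp at hu
      exact ⟨u, by rw [hp'o u hua, hu]⟩
    · have hyb : y ≠ b := fun h => hpy (by rw [h, hp'b])
      rw [hpt y hyb]
      by_cases hya : y = a
      · rw [hya]
        exact ha.2.2
      · exact hp.even y hy (by rwa [hp'o y hya] at hpy)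
    · by_cases hwa : w = a
      · rw [hwa, hp'a, Option.some_inj] at hw
        rw [← hw, hp'b] at hy
        simp at hy
      · by_cases hya : y = a
        · rw [hya, hp'a, Option.some_inj] at hy
          rw [← hy, hp'b] at hw
          simp at hw
        · rw [hp'o w hwa] at hw
          rw [hp'o y hya] at hy
          exact hp.asymm w y hw hy
  refine ih _ ?_ p' hpointer rfl
  rw [← hn]
  refine Finset.card_lt_card (Finset.ssubset_iff_of_subset ?_ |>.mpr ⟨a, by simp [ha], ?_⟩)
  · intro y hy
    simp only [Finset.mem_filter, Finset.mem_univ, true_and] at hy ⊢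
    have hya : y ≠ a := fun h => by have := hy.2.1; rw [h, hp'a] at this; simp at this
    have hyb : y ≠ b := fun h => hodd (h ▸ hy.2.2)
    exact ⟨hy.1, by rw [← hp'o y hya]; exact hy.2.1, by rw [← hpt y hyb]; exact hy.2.2⟩
  · intro h
    have := (Finset.mem_filter.mp h).2.2.1
    rw [hp'a] at this
    simp at this

/-- A finite set has an involution with `r` fixed points if `r` is at most its size and of the same
parity. -/
theorem exists_involution {α : Type*} [DecidableEq α] (s : Finset α) (r : ℕ) (hr : r ≤ s.card)
    (hpar : Even (s.card - r)) :
    ∃ f : α → α, (∀ x ∈ s, f x ∈ s) ∧ (∀ x, f (f x) = x) ∧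
      (s.filter (fun x => f x = x)).card = r := by
  obtain ⟨m, hm⟩ := hpar
  suffices h : ∀ (m : ℕ) (s : Finset α), s.card = r + 2 * m →
      ∃ f : α → α, (∀ x ∈ s, f x ∈ s) ∧ (∀ x, f (f x) = x) ∧ (∀ x, x ∉ s → f x = x) ∧
        (s.filter (fun x => f x = x)).card = r by
    obtain ⟨f, h1, h2, -, h3⟩ := h m s (by omega)
    exact ⟨f, h1, h2, h3⟩
  intro m
  induction m with
  | zero =>
    intro s hs
    exact ⟨id, by simp, by simp, by simp, by simp [hs]⟩
  | succ m ih =>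
    intro s hs
    obtain ⟨a, ha, b, hb, hab⟩ := Finset.one_lt_card.mp (show 1 < s.card by omega)
    obtain ⟨f, h1, h2, h3, h4⟩ := ih ((s.erase a).erase b) (by
      rw [Finset.card_erase_of_mem (Finset.mem_erase.mpr ⟨hab.symm, hb⟩),
        Finset.card_erase_of_mem ha]
      omega)
    have hfa : f a = a := h3 a (by simp)
    have hfb : f b = b := h3 b (by simp)
    have hne : ∀ x, x ≠ a → x ≠ b → f x ≠ a ∧ f x ≠ b := by
      intro x hxa hxb
      refine ⟨fun h => hxa ?_, fun h => hxb ?_⟩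
      · rw [← h2 x, h, hfa]
      · rw [← h2 x, h, hfb]
    have hg : ∀ x, x ≠ a → x ≠ b → Equiv.swap a b (f x) = f x := fun x hxa hxb =>
      Equiv.swap_apply_of_ne_of_ne (hne x hxa hxb).1 (hne x hxa hxb).2
    have hga : Equiv.swap a b (f a) = b := by rw [hfa, Equiv.swap_apply_left]
    have hgb : Equiv.swap a b (f b) = a := by rw [hfb, Equiv.swap_apply_right]
    refine ⟨fun x => Equiv.swap a b (f x), fun x hx => ?_, fun x => ?_, fun x hx => ?_, ?_⟩
    · dsimp only
      by_cases hxa : x = a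
      · rw [hxa, hga]; exact hb
      by_cases hxb : x = b
      · rw [hxb, hgb]; exact ha
      rw [hg x hxa hxb]
      exact Finset.mem_of_mem_erase (Finset.mem_of_mem_erase (h1 x (by simp [hxa, hxb, hx])))
    · dsimp only
      by_cases hxa : x = a
      · rw [hxa, hga, hgb]
      by_cases hxb : x = b
      · rw [hxb, hgb, hga]
      rw [hg x hxa hxb, hg _ (hne x hxa hxb).1 (hne x hxa hxb).2, h2]
    · have hxa : x ≠ a := fun h => hx (h ▸ ha)
      have hxb : x ≠ b := fun h => hx (h ▸ hb)
      dsimp only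
      rw [hg x hxa hxb]
      exact h3 x (by simp [hx])
    · rw [← h4]
      congr 1
      ext x
      simp only [Finset.mem_filter, Finset.mem_erase]
      by_cases hxa : x = a
      · simp [hxa, hga, hab.symm]
      by_cases hxb : x = b
      · simp [hxb, hgb, hab]
      rw [hg x hxa hxb]
      simp [hxa, hxb]

/-- Pointers together with an involution `swap` on the vertices with a pointer, preserving targets.
The fixed points of `swap` count as unpaired. -/
structure PairedPointers (H : SimpleGraph V) (Q : V → Prop) where
  ptr : V → Option V
  swap : V → V
  adj : ∀ w y, ptr w = some y → H.Adj w y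
  dom : ∀ w y, ptr w = some y → Q w
  asymm : ∀ w y, ptr w = some y → ptr y ≠ some w
  ptr_swap : ∀ w, ptr (swap w) = ptr w
  swap_swap : ∀ w, swap (swap w) = w

open Classical in
/-- The unpaired vertices with pointer to `y`. -/
noncomputable def PairedPointers.unpaired {H : SimpleGraph V} {Q : V → Prop}
    (P : PairedPointers H Q) (y : V) : Finset V :=
  {w | P.ptr w = some y ∧ P.swap w = w}

theorem PairedPointers.mem_unpaired {H : SimpleGraph V} {Q : V → Prop}
    {P : PairedPointers H Q} {y w : V} : w ∈ P.unpaired y ↔ P.ptr w = some y ∧ P.swap w = w := by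
  simp [unpaired]

/-- The pointers can be paired up such that a vertex satisfying `Q` is the target of no unpaired
pointer if it has a pointer itself, and of one or two if it has none. The vertices which are the
target of two form an independent set. -/
theorem exists_pairedPointers (H : SimpleGraph V) (Q : V → Prop)
    (hQ : ∀ w, Q w → ∃ v, H.Adj w v) :
    ∃ P : PairedPointers H Q,
      (∀ y, Q y → P.ptr y ≠ none → (P.unpaired y).card = 0) ∧
      (∀ y, Q y → P.ptr y = none → (P.unpaired y).Nonempty) ∧
      (∀ y, (P.unpaired y).card ≤ 2) ∧
      (∀ y, ¬ Q y → (P.unpaired y).card ≤ 1) ∧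
      (∀ y₁ y₂, (P.unpaired y₁).card = 2 → (P.unpaired y₂).card = 2 → ¬ H.Adj y₁ y₂) := by
  classical
  obtain ⟨p, hp, hX⟩ := exists_isPointer H Q hQ
  set r : V → ℕ := fun y => if Q y then
      (if p y = none then (if Even (pointersTo p y).card then 2 else 1) else 0)
    else (pointersTo p y).card % 2 with hr
  have hpos : ∀ y, Q y → p y = none → 0 < (pointersTo p y).card := by
    intro y hy hpy
    obtain ⟨u, hu⟩ := hp.exists_pointer y hy hpy
    exact Finset.card_pos.mpr ⟨u, mem_pointersTo.mpr hu⟩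
  have hinv : ∀ y, ∃ f : V → V, (∀ x ∈ pointersTo p y, f x ∈ pointersTo p y) ∧
      (∀ x, f (f x) = x) ∧ ((pointersTo p y).filter (fun x => f x = x)).card = r y := by
    intro y
    refine exists_involution _ _ ?_ ?_
    · simp only [hr]
      split_ifs with h1 h2 h3
      · have := hpos y h1 h2
        obtain ⟨k, hk⟩ := h3
        omega
      · exact hpos y h1 h2
      · exact Nat.zero_le _
      · exact Nat.mod_le _ _
    · simp only [hr]
      split_ifs with h1 h2 h3
      · obtain ⟨k, hk⟩ := h3
        exact ⟨k - 1, by omega⟩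
      · rw [Nat.not_even_iff_odd] at h3
        obtain ⟨k, hk⟩ := h3
        exact ⟨k, by omega⟩
      · exact hp.even y h1 h2
      · exact ⟨(pointersTo p y).card / 2, by omega⟩
  choose f hf1 hf2 hf3 using hinv
  set τ : V → V := fun w => match p w with
    | some y => f y w
    | none => w with hτ
  have hτs : ∀ w y, p w = some y → τ w = f y w := fun w y h => by simp [hτ, h]
  have hτn : ∀ w, p w = none → τ w = w := fun w h => by simp [hτ, h]
  have hpτ : ∀ w, p (τ w) = p w := by
    intro w
    rcases h : p w with _ | y
    · rw [hτn w h, h]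
    · rw [hτs w y h]
      exact mem_pointersTo.mp (hf1 y w (mem_pointersTo.mpr h))
  have hττ : ∀ w, τ (τ w) = w := by
    intro w
    rcases h : p w with _ | y
    · rw [hτn w h, hτn w h]
    · rw [hτs (τ w) y (by rw [hpτ, h]), hτs w y h, hf2]
  refine ⟨⟨p, τ, hp.adj, hp.dom, hp.asymm, hpτ, hττ⟩, ?_⟩
  set P : PairedPointers H Q := ⟨p, τ, hp.adj, hp.dom, hp.asymm, hpτ, hττ⟩ with hP
  have hcard : ∀ y, (P.unpaired y).card = r y := by
    intro y
    rw [← hf3 y]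
    congr 1
    ext w
    rw [PairedPointers.mem_unpaired, Finset.mem_filter, mem_pointersTo]
    refine and_congr_right fun h => ?_
    change τ w = w ↔ _
    rw [hτs w y h]
  have htwo : ∀ y, (P.unpaired y).card = 2 → IsEvenCenter Q p y := by
    intro y hy
    rw [hcard] at hy
    simp only [hr] at hy
    split_ifs at hy with h1 h2 h3
    · exact ⟨h1, h2, h3⟩
    all_goals omega
  refine ⟨fun y h1 h2 => ?_, fun y h1 h2 => ?_, fun y => ?_, fun y h1 => ?_, fun a b ha hb => ?_⟩
  · rw [hcard]
    have h2' : p y ≠ none := h2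
    simp [hr, h1, h2']
  · rw [← Finset.card_pos, hcard]
    have h2' : p y = none := h2
    simp only [hr, h1, h2', if_true]
    split_ifs <;> omega
  · rw [hcard]
    simp only [hr]
    split_ifs <;> omega
  · rw [hcard]
    simp only [hr, h1, if_false]
    omega
  · exact hX a b (htwo a ha) (htwo b hb)

end Pointers

/-! ### An independent set meeting the closed neighbourhood of every vertex -/

section IndependentSet

variable {V : Type*}

/-- A vertex outside `B` with at most one neighbour in `B`. -/
def IsPrivate (G : SimpleGraph V) (B : Set V) (w : V) : Prop :=
  w ∉ B ∧ ∀ b ∈ B, ∀ b' ∈ B, G.Adj w b → G.Adj w b' → b = b'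

/-- The edges of `G` with both ends outside `B`. -/
def outside (G : SimpleGraph V) (B : Set V) : SimpleGraph V where
  Adj v w := G.Adj v w ∧ v ∉ B ∧ w ∉ B
  symm := ⟨fun _ _ h => ⟨h.1.symm, h.2.2, h.2.1⟩⟩
  loopless := ⟨fun _ h => h.1.ne rfl⟩

/-- The set is an independent set of maximum weight, where a leaf has weight `3` and every other
vertex has weight `2`. The three last properties hold because adding `w`, exchanging a leaf for its
neighbour, and exchanging a common neighbour for two non-adjacent private vertices would each
increase the weight. -/
theorem exists_dominating_indep [Fintype V] (G : SimpleGraph V)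
    (hG : ∀ u v, G.Adj u v → (∃ x, x ≠ v ∧ G.Adj u x) ∨ ∃ x, x ≠ u ∧ G.Adj v x) :
    ∃ B : Set V, (∀ a ∈ B, ∀ b ∈ B, ¬ G.Adj a b) ∧
      (∀ w ∉ B, ∃ b ∈ B, G.Adj w b) ∧
      (∀ w, IsPrivate G B w → ∃ v, (outside G B).Adj w v) ∧
      (∀ w w' b, IsPrivate G B w → IsPrivate G B w' → w ≠ w' → b ∈ B → G.Adj w b → G.Adj w' b →
        G.Adj w w') := by
  classical
  set leaf : V → Prop := fun v => ∃ u, ∀ x, G.Adj v x → x = u with hleaf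
  set wt : V → ℕ := fun v => 2 + if leaf v then 1 else 0 with hwt
  have wt2 : ∀ v, 2 ≤ wt v := fun v => Nat.le_add_right _ _
  have wt3 : ∀ v, wt v ≤ 3 := fun v => by
    simp only [hwt]
    split_ifs <;> omega
  set F : Finset (Finset V) := Finset.univ.filter fun B => ∀ a ∈ B, ∀ b ∈ B, ¬ G.Adj a b with hF
  obtain ⟨B, hB, hmax⟩ := Finset.exists_max_image F (fun B => ∑ v ∈ B, wt v) ⟨∅, by simp [hF]⟩
  have hind : ∀ a ∈ B, ∀ b ∈ B, ¬ G.Adj a b := (Finset.mem_filter.mp hB).2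
  have hmax' : ∀ B' : Finset V, (∀ a ∈ B', ∀ b ∈ B', ¬ G.Adj a b) →
      ∑ v ∈ B', wt v ≤ ∑ v ∈ B, wt v := fun B' h => hmax B' (by simpa [hF] using h)
  have hdom : ∀ w ∉ B, ∃ b ∈ B, G.Adj w b := by
    intro w hw
    by_contra! hn
    have := hmax' (insert w B) (by
      intro a ha b hb hab
      simp only [Finset.mem_insert] at ha hb
      rcases ha with rfl | ha <;> rcases hb with rfl | hb
      · exact hab.ne rfl
      · exact hn b hb hab
      · exact hn a ha hab.symm
      · exact hind a ha b hb hab)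
    rw [Finset.sum_insert hw] at this
    have := wt2 w
    omega
  refine ⟨B, hind, hdom, fun w hw => ?_, fun w w' b hw hw' hne hb hwb hwb' => ?_⟩
  · by_contra! hn
    obtain ⟨hwB, huniq⟩ := hw
    have hwB' : w ∉ B := hwB
    obtain ⟨b, hb, hwb⟩ := hdom w hwB'
    have honly : ∀ x, G.Adj w x → x = b := fun x hx => by
      by_cases hxB : x ∈ B
      · exact huniq x hxB b hb hx hwb
      · exact absurd ⟨hx, hwB', hxB⟩ (hn x)
    have hbleaf : ¬ leaf b := by
      rintro ⟨u, hu⟩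
      rcases hG w b hwb with ⟨x, hxb, hx⟩ | ⟨x, hxw, hx⟩
      · exact hxb (honly x hx)
      · exact hxw ((hu x hx).trans (hu w hwb.symm).symm)
    have := hmax' (insert w (B.erase b)) (by
      intro x hx y hy hxy
      simp only [Finset.mem_insert] at hx hy
      rcases hx with rfl | hx <;> rcases hy with rfl | hy
      · exact hxy.ne rfl
      · exact Finset.ne_of_mem_erase hy (honly y hxy)
      · exact Finset.ne_of_mem_erase hx (honly x hxy.symm)
      · exact hind x (Finset.mem_of_mem_erase hx) y (Finset.mem_of_mem_erase hy) hxy)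
    rw [Finset.sum_insert (fun h => hwB' (Finset.mem_of_mem_erase h)),
      ← Finset.add_sum_erase B wt hb] at this
    have h1 : wt w = 3 := by simp [hwt, show leaf w from ⟨b, honly⟩]
    have h2 : wt b = 2 := by simp [hwt, hbleaf]
    omega
  · by_contra hn
    have hwB : w ∉ B := hw.1
    have hwB' : w' ∉ B := hw'.1
    have ow : ∀ x ∈ B.erase b, ¬ G.Adj w x := fun x hx h =>
      Finset.ne_of_mem_erase hx (hw.2 x (Finset.mem_of_mem_erase hx) b hb h hwb)
    have ow' : ∀ x ∈ B.erase b, ¬ G.Adj w' x := fun x hx h =>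
      Finset.ne_of_mem_erase hx (hw'.2 x (Finset.mem_of_mem_erase hx) b hb h hwb')
    have := hmax' (insert w (insert w' (B.erase b))) (by
      intro x hx y hy hxy
      simp only [Finset.mem_insert] at hx hy
      rcases hx with rfl | rfl | hx <;> rcases hy with rfl | rfl | hy
      · exact hxy.ne rfl
      · exact hn hxy
      · exact ow y hy hxy
      · exact hn hxy.symm
      · exact hxy.ne rfl
      · exact ow' y hy hxy
      · exact ow x hx hxy.symm
      · exact ow' x hx hxy.symm
      · exact hind x (Finset.mem_of_mem_erase hx) y (Finset.mem_of_mem_erase hy) hxy)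
    rw [Finset.sum_insert, Finset.sum_insert (fun h => hwB' (Finset.mem_of_mem_erase h)),
      ← Finset.add_sum_erase B wt hb] at this
    · have := wt2 w
      have := wt2 w'
      have := wt3 b
      omega
    · intro h
      rcases Finset.mem_insert.mp h with h | h
      · exact hne h
      · exact hwB (Finset.mem_of_mem_erase h)

end IndependentSet

/-! ### The forms -/

section Layout

variable {V : Type*} [Fintype V] [LinearOrder V]

open Classical in
/-- The last neighbour of `w` in the order (`w` itself if there is none). -/
noncomputable def lastNbr (G : SimpleGraph V) (w : V) : V :=
  if h : ∃ v, G.Adj w v ∧ ∀ u, G.Adj w u → u ≤ v then h.choose else w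

open Classical in
/-- The first neighbour of `w` after `v` in the order (`v` itself if there is none). -/
noncomputable def nextNbr (G : SimpleGraph V) (w v : V) : V :=
  if h : ∃ u, (G.Adj w u ∧ v < u) ∧ ∀ x, G.Adj w x → v < x → u ≤ x then h.choose else v

theorem lastNbr_spec {G : SimpleGraph V} {w v : V} (h : G.Adj w v) :
    G.Adj w (lastNbr G w) ∧ ∀ u, G.Adj w u → u ≤ lastNbr G w := by
  classical
  have h' : ∃ v, G.Adj w v ∧ ∀ u, G.Adj w u → u ≤ v := by
    obtain ⟨m, hm, hmax⟩ := Finset.exists_max_image (Finset.univ.filter (G.Adj w)) id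
      ⟨v, by simpa using h⟩
    exact ⟨m, by simpa using hm, fun u hu => hmax u (by simpa using hu)⟩
  rw [lastNbr, dif_pos h']
  exact h'.choose_spec

theorem nextNbr_spec {G : SimpleGraph V} {w v : V} (h : G.Adj w v) (hv : v ≠ lastNbr G w) :
    (G.Adj w (nextNbr G w v) ∧ v < nextNbr G w v) ∧
      ∀ x, G.Adj w x → v < x → nextNbr G w v ≤ x := by
  classical
  obtain ⟨h1, h2⟩ := lastNbr_spec h
  have h' : ∃ u, (G.Adj w u ∧ v < u) ∧ ∀ x, G.Adj w x → v < x → u ≤ x := by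
    obtain ⟨m, hm, hmin⟩ := Finset.exists_min_image
      (Finset.univ.filter fun u => G.Adj w u ∧ v < u) id
      ⟨lastNbr G w, by simpa using ⟨h1, lt_of_le_of_ne (h2 v h) hv⟩⟩
    exact ⟨m, by simpa using hm, fun u hu hvu => hmin u (by simpa using ⟨hu, hvu⟩)⟩
  rw [nextNbr, dif_pos h']
  exact h'.choose_spec

theorem nextNbr_injective {G : SimpleGraph V} {w v v' : V} (h : G.Adj w v)
    (hv : v ≠ lastNbr G w) (h' : G.Adj w v') (hv' : v' ≠ lastNbr G w)
    (heq : nextNbr G w v = nextNbr G w v') : v = v' := by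
  have s := nextNbr_spec h hv
  have s' := nextNbr_spec h' hv'
  rcases lt_trichotomy v v' with hlt | heq | hlt
  · exact absurd (s.2 v' h' hlt) (not_le.mpr (heq ▸ s'.1.2))
  · exact heq
  · exact absurd (s'.2 v h hlt) (not_le.mpr (heq ▸ s.1.2))

/-- The combinatorial input for the forms: an independent dominating set `B` at the end of the order,
and paired pointers on the private vertices. The target of two unpaired pointers is preceded by
all its neighbours outside `B`. -/
structure Layout (G : SimpleGraph V) (B : Set V) where
  indep : ∀ a ∈ B, ∀ b ∈ B, ¬ G.Adj a b
  dom : ∀ w ∉ B, ∃ b ∈ B, G.Adj w b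
  adj_of_private : ∀ w w' b, IsPrivate G B w → IsPrivate G B w' → w ≠ w' → b ∈ B →
    G.Adj w b → G.Adj w' b → G.Adj w w'
  lt_of_mem : ∀ a ∉ B, ∀ b ∈ B, a < b
  pointers : PairedPointers (outside G B) (IsPrivate G B)
  unpaired_eq_zero : ∀ y, IsPrivate G B y → pointers.ptr y ≠ none → (pointers.unpaired y).card = 0
  unpaired_nonempty : ∀ y, IsPrivate G B y → pointers.ptr y = none → (pointers.unpaired y).Nonempty
  unpaired_le_two : ∀ y, (pointers.unpaired y).card ≤ 2
  unpaired_le_one : ∀ y, ¬ IsPrivate G B y → (pointers.unpaired y).card ≤ 1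
  lt_of_unpaired : ∀ y, (pointers.unpaired y).card = 2 → ∀ v, (outside G B).Adj y v → v < y

namespace Layout

variable {G : SimpleGraph V} {B : Set V} (S : Layout G B)

include S

theorem adj_last {w : V} (hw : w ∉ B) : G.Adj w (lastNbr G w) := by
  obtain ⟨b, -, h⟩ := S.dom w hw
  exact (lastNbr_spec h).1

theorem last_mem {w : V} (hw : w ∉ B) : lastNbr G w ∈ B := by
  obtain ⟨b, hb, h⟩ := S.dom w hw
  by_contra hn
  exact absurd (S.lt_of_mem _ hn b hb) (not_lt.mpr ((lastNbr_spec h).2 b h))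

theorem mem_of_le {b c : V} (hb : b ∈ B) (h : b ≤ c) : c ∈ B := by
  by_contra hn
  exact absurd (S.lt_of_mem _ hn b hb) (not_lt.mpr h)

theorem low_notMem {p : V × V} (hp : p ∈ orientedEdges G) : p.2 ∉ B := by
  intro h
  have hp' := mem_orientedEdges.mp hp
  exact S.indep _ (S.mem_of_le h hp'.2.le) _ h hp'.1

theorem ne_last {w v : V} (hw : w ∉ B) (hv : v ∉ B) : v ≠ lastNbr G w := fun h =>
  hv (h ▸ S.last_mem hw)

end Layout

end Layout

theorem mk_eq_of_mem {V : Type*} {B : Set V} {w b w' b' : V} (hw : w ∉ B) (hb' : b' ∈ B)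
    (h : (s(w, b) : Sym2 V) = s(w', b')) : w = w' ∧ b = b' := by
  rcases Sym2.eq_iff.mp h with h | h
  · exact h
  · exact absurd (h.1 ▸ hb') hw

theorem mk_eq_of_lt {V : Type*} [LinearOrder V] {w v w' v' : V} (h1 : w < v) (h2 : w' < v')
    (h : (s(w, v) : Sym2 V) = s(w', v')) : w = w' ∧ v = v' := by
  rcases Sym2.eq_iff.mp h with h | ⟨rfl, rfl⟩
  · exact h
  · exact absurd h1 (not_lt.mpr h2.le)

section LayoutTokens

variable {V : Type*} [Fintype V] [LinearOrder V]

namespace Layout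

variable {G : SimpleGraph V} {B : Set V} (S : Layout G B)

/-- The edges with higher end in `B`, as pairs (higher end, lower end), except the last edge at each
lower end. -/
abbrev ChainIndex (G : SimpleGraph V) (B : Set V) : Type _ :=
  {p : V × V // p ∈ orientedEdges G ∧ p.1 ∈ B ∧ p.1 ≠ lastNbr G p.2}

/-- The orbits of the pairing of pointers, each represented by its smallest element `q.1`; the common
target is `q.2`. -/
abbrev OrbitIndex : Type _ :=
  {q : V × V // S.pointers.ptr q.1 = some q.2 ∧ q.1 ≤ S.pointers.swap q.1}

open Classical in
/-- The vertex paired with `q.1`; if `q.1` is unpaired, its target `q.2`. -/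
noncomputable def partner (q : V × V) : V :=
  if S.pointers.swap q.1 = q.1 then q.2 else S.pointers.swap q.1

open Classical in
/-- The form of an orbit of pointers. The signs are such that the vertices outside `B` cancel when
every edge is replaced by the sum of its ends. -/
noncomputable def orbitForm (q : V × V) : MvPolynomial (Sym2 V) ℤ :=
  if S.pointers.swap q.1 = q.1 then
    X s(q.1, lastNbr G q.1) - X s(q.1, q.2) + X s(q.2, lastNbr G q.2)
  else if G.Adj q.1 (S.pointers.swap q.1) then
    X s(q.1, lastNbr G q.1) + X s(S.pointers.swap q.1, lastNbr G (S.pointers.swap q.1))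
      - X s(q.1, S.pointers.swap q.1)
  else
    X s(q.1, lastNbr G q.1) - X s(q.1, q.2) + X s(S.pointers.swap q.1, q.2)
      - X s(S.pointers.swap q.1, lastNbr G (S.pointers.swap q.1))

open Classical in
/-- The sign between the two vertices of `B` in the image of `orbitForm`. -/
noncomputable def orbitSign (q : V × V) : ℤ :=
  if S.pointers.swap q.1 = q.1 ∨ G.Adj q.1 (S.pointers.swap q.1) then 1 else -1

/-- The edge `e` may occur in the form of the orbit `q`. -/
def orbitUses (q : V × V) (e : Sym2 V) : Prop :=
  (e = s(q.1, lastNbr G q.1) ∨ e = s(S.partner q, lastNbr G (S.partner q))) ∨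
    (e = s(q.1, q.2) ∨ e = s(S.pointers.swap q.1, q.2)) ∨ e = s(q.1, S.pointers.swap q.1)
      ∧ G.Adj q.1 (S.pointers.swap q.1)

/-- The edge `e` occurs in the difference of the edge `p` and its successor at the lower end. -/
def chainUses (G : SimpleGraph V) (p : V × V) (e : Sym2 V) : Prop :=
  e = s(p.2, p.1) ∨ e = s(p.2, nextNbr G p.2 p.1)

theorem swap_ptr {w y : V} (h : S.pointers.ptr w = some y) :
    S.pointers.ptr (S.pointers.swap w) = some y := by
  rw [S.pointers.ptr_swap, h]

theorem isPrivate_of_ptr {w y : V} (h : S.pointers.ptr w = some y) : IsPrivate G B w :=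
  S.pointers.dom w y h

theorem adj_of_ptr {w y : V} (h : S.pointers.ptr w = some y) : G.Adj w y := (S.pointers.adj w y h).1

theorem notMem_of_ptr {w y : V} (h : S.pointers.ptr w = some y) : w ∉ B := (S.pointers.adj w y h).2.1

theorem target_notMem {w y : V} (h : S.pointers.ptr w = some y) : y ∉ B := (S.pointers.adj w y h).2.2

theorem partner_notMem {q : V × V} (h : S.pointers.ptr q.1 = some q.2) : S.partner q ∉ B := by
  rw [partner]
  split_ifs
  · exact S.target_notMem h
  · exact S.notMem_of_ptr (S.swap_ptr h)

theorem aeval_orbitForm {q : V × V} (h : S.pointers.ptr q.1 = some q.2) :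
    aeval (endSum G) (S.orbitForm q)
      = X (lastNbr G q.1) + C (S.orbitSign q) * X (lastNbr G (S.partner q)) := by
  have e1 := endSum_mk (S.adj_last (S.notMem_of_ptr h))
  have e2 := endSum_mk (S.adj_of_ptr h)
  have e3 := endSum_mk (S.adj_last (S.target_notMem h))
  have e4 := endSum_mk (S.adj_last (S.notMem_of_ptr (S.swap_ptr h)))
  have e5 := endSum_mk (S.adj_of_ptr (S.swap_ptr h))
  rw [orbitForm, orbitSign, partner]
  by_cases h1 : S.pointers.swap q.1 = q.1
  · simp only [h1, if_true, true_or, map_add, map_sub, aeval_X, e1, e2, e3, C_1]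
    ring
  · by_cases h2 : G.Adj q.1 (S.pointers.swap q.1)
    · simp only [h1, h2, if_true, if_false, or_true, map_add, map_sub, aeval_X, e1, e4,
        endSum_mk h2, C_1]
      ring
    · simp only [h1, h2, if_false, or_false, map_add, map_sub, aeval_X, e1, e2, e4, e5, map_neg,
        C_1]
      ring

theorem degreeOf_orbitForm (q : V × V) (e : Sym2 V) :
    degreeOf e (S.orbitForm q) ≤ open Classical in if S.orbitUses q e then 1 else 0 := by
  classical
  have hp : S.pointers.swap q.1 = q.1 → S.partner q = q.2 := fun h => by rw [partner, if_pos h]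
  have hp' : S.pointers.swap q.1 ≠ q.1 → S.partner q = S.pointers.swap q.1 := fun h => by
    rw [partner, if_neg h]
  rw [orbitForm]
  by_cases h1 : S.pointers.swap q.1 = q.1
  · rw [if_pos h1]
    refine degreeOf_add_le_of_le (degreeOf_sub_le_of_le (degreeOf_X_le fun h => ?_)
      (degreeOf_X_le fun h => ?_)) (degreeOf_X_le fun h => ?_)
    · exact Or.inl (Or.inl h)
    · exact Or.inr (Or.inl (Or.inl h))
    · exact Or.inl (Or.inr (by rw [hp h1]; exact h))
  rw [if_neg h1]
  by_cases h2 : G.Adj q.1 (S.pointers.swap q.1)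
  · rw [if_pos h2]
    refine degreeOf_sub_le_of_le (degreeOf_add_le_of_le (degreeOf_X_le fun h => ?_)
      (degreeOf_X_le fun h => ?_)) (degreeOf_X_le fun h => ?_)
    · exact Or.inl (Or.inl h)
    · exact Or.inl (Or.inr (by rw [hp' h1]; exact h))
    · exact Or.inr (Or.inr ⟨h, h2⟩)
  · rw [if_neg h2]
    refine degreeOf_sub_le_of_le (degreeOf_add_le_of_le (degreeOf_sub_le_of_le
      (degreeOf_X_le fun h => ?_) (degreeOf_X_le fun h => ?_)) (degreeOf_X_le fun h => ?_))
      (degreeOf_X_le fun h => ?_)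
    · exact Or.inl (Or.inl h)
    · exact Or.inr (Or.inl (Or.inl h))
    · exact Or.inr (Or.inl (Or.inr h))
    · exact Or.inl (Or.inr (by rw [hp' h1]; exact h))

/-- Two non-adjacent private vertices have different neighbours in `B`, so a form with sign `-1` does
not become zero. -/
theorem orbitSign_eq {q : V × V} (h : S.pointers.ptr q.1 = some q.2)
    (heq : lastNbr G q.1 = lastNbr G (S.partner q)) : S.orbitSign q = 1 := by
  rw [orbitSign]
  split_ifs with h1
  · rfl
  · push Not at h1
    rw [partner, if_neg h1.1] at heq
    have hq := S.notMem_of_ptr h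
    have hs := S.notMem_of_ptr (S.swap_ptr h)
    refine absurd (S.adj_of_private _ _ _ (S.isPrivate_of_ptr h)
      (S.isPrivate_of_ptr (S.swap_ptr h)) (Ne.symm h1.1) (S.last_mem hq) (S.adj_last hq) ?_) h1.2
    rw [heq]
    exact S.adj_last hs

/-! ### Every edge variable is used at most four times -/

theorem eq_or_next_of_chainUses {w v : V} (hwv : w < v) {p : V × V} (hp : p ∈ orientedEdges G)
    (hl : p.1 ≠ lastNbr G p.2) (h : chainUses G p s(w, v)) :
    p = (v, w) ∨ p.2 = w ∧ nextNbr G p.2 p.1 = v := by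
  obtain ⟨hadj, hlt⟩ := mem_orientedEdges.mp hp
  rcases h with h | h
  · obtain ⟨h1, h2⟩ := mk_eq_of_lt hwv hlt h
    left
    rw [h1, h2]
  · obtain ⟨h1, h2⟩ := mk_eq_of_lt hwv (hlt.trans (nextNbr_spec hadj.symm hl).1.2) h
    exact Or.inr ⟨h1.symm, h2.symm⟩

open Classical in
/-- The edge at `w` that precedes the edge `wv` in the order of the higher ends, as a set. -/
noncomputable def predecessor (G : SimpleGraph V) (w v : V) : Finset (V × V) :=
  (orientedEdges G).filter fun p => p.1 ≠ lastNbr G p.2 ∧ p.2 = w ∧ nextNbr G p.2 p.1 = v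

theorem card_predecessor_le_one (G : SimpleGraph V) (w v : V) : (predecessor G w v).card ≤ 1 := by
  classical
  refine Finset.card_le_one.mpr fun p hp q hq => ?_
  simp only [predecessor, Finset.mem_filter, mem_orientedEdges] at hp hq
  obtain ⟨⟨hp1, -⟩, hp2, rfl, hp4⟩ := hp
  obtain ⟨⟨hq1, -⟩, hq2, hq3, hq4⟩ := hq
  rw [hq3] at hq2 hq1 hq4
  exact Prod.ext (nextNbr_injective hp1.symm hp2 hq1.symm hq2 (hp4.trans hq4.symm)) hq3.symm

open Classical in
/-- The edges outside `B` whose chain form uses `e`. -/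
noncomputable def linkUsers (G : SimpleGraph V) (B : Set V) (e : Sym2 V) : Finset (V × V) :=
  (orientedEdges G).filter fun p => p.1 ∉ B ∧ chainUses G p e

open Classical in
/-- The edges to `B` whose chain form uses `e`. -/
noncomputable def chainUsers (G : SimpleGraph V) (B : Set V) (e : Sym2 V) : Finset (V × V) :=
  (orientedEdges G).filter fun p => (p.1 ∈ B ∧ p.1 ≠ lastNbr G p.2) ∧ chainUses G p e

open Classical in
/-- The orbits whose form uses `e`. -/
noncomputable def orbitUsers (e : Sym2 V) : Finset (V × V) :=
  Finset.univ.filter fun q =>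
    (S.pointers.ptr q.1 = some q.2 ∧ q.1 ≤ S.pointers.swap q.1) ∧ S.orbitUses q e

theorem mem_orbitUsers {e : Sym2 V} {q : V × V} : q ∈ S.orbitUsers e ↔
    (S.pointers.ptr q.1 = some q.2 ∧ q.1 ≤ S.pointers.swap q.1) ∧ S.orbitUses q e := by
  simp [orbitUsers]

include S

theorem linkUsers_cross {w b : V} (hw : w ∉ B) (hb : b ∈ B) {p : V × V}
    (hp : p ∈ linkUsers G B s(w, b)) : p ∈ predecessor G w b ∧ p.1 ∉ B := by
  simp only [linkUsers, Finset.mem_filter] at hp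
  obtain ⟨hp1, hp2, hp3⟩ := hp
  have hl := S.ne_last (S.low_notMem hp1) hp2
  rcases eq_or_next_of_chainUses (S.lt_of_mem w hw b hb) hp1 hl hp3 with h | h
  · rw [h] at hp2
    exact absurd hb hp2
  · exact ⟨by simp only [predecessor, Finset.mem_filter]; exact ⟨hp1, hl, h⟩, hp2⟩

theorem chainUsers_cross {w b : V} (hw : w ∉ B) (hb : b ∈ B) {p : V × V}
    (hp : p ∈ chainUsers G B s(w, b)) :
    p.1 ∈ B ∧ p.1 ≠ lastNbr G p.2 ∧ (p = (b, w) ∨ p ∈ predecessor G w b) := by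
  simp only [chainUsers, Finset.mem_filter] at hp
  obtain ⟨hp1, ⟨hp2, hl⟩, hp3⟩ := hp
  refine ⟨hp2, hl, ?_⟩
  rcases eq_or_next_of_chainUses (S.lt_of_mem w hw b hb) hp1 hl hp3 with h | h
  · exact Or.inl h
  · exact Or.inr (by simp only [predecessor, Finset.mem_filter]; exact ⟨hp1, hl, h⟩)

theorem card_star_cross {w b : V} (hw : w ∉ B) (hb : b ∈ B) :
    (linkUsers G B s(w, b)).card + 2 * (chainUsers G B s(w, b)).card ≤ 4 ∧
    (b = lastNbr G w →
      (linkUsers G B s(w, b)).card + 2 * (chainUsers G B s(w, b)).card ≤ 2) := by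
  classical
  have hcard := card_predecessor_le_one G w b
  rw [← Finset.card_filter_add_card_filter_not (fun p : V × V => p.1 ∈ B)] at hcard
  have h1 : (linkUsers G B s(w, b)).card
      ≤ ((predecessor G w b).filter fun p : V × V => ¬ p.1 ∈ B).card :=
    Finset.card_le_card fun p hp => Finset.mem_filter.mpr (S.linkUsers_cross hw hb hp)
  have h2 : (chainUsers G B s(w, b)).card
      ≤ ((predecessor G w b).filter fun p : V × V => p.1 ∈ B).card + 1 := by
    refine (Finset.card_le_card fun p hp => ?_).trans (Finset.card_insert_le (b, w) _)
    obtain ⟨h3, -, h4⟩ := S.chainUsers_cross hw hb hp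
    rcases h4 with h4 | h4
    · exact Finset.mem_insert.mpr (Or.inl h4)
    · exact Finset.mem_insert.mpr (Or.inr (Finset.mem_filter.mpr ⟨h4, h3⟩))
  refine ⟨by omega, fun hl => ?_⟩
  have h3 : (chainUsers G B s(w, b)).card
      ≤ ((predecessor G w b).filter fun p : V × V => p.1 ∈ B).card := by
    refine Finset.card_le_card fun p hp => ?_
    obtain ⟨h3, h4, h5⟩ := S.chainUsers_cross hw hb hp
    rcases h5 with h5 | h5
    · rw [h5] at h4
      exact absurd hl h4
    · exact Finset.mem_filter.mpr ⟨h5, h3⟩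
  omega

theorem card_star_private {w b : V} (hw : IsPrivate G B w) (hb : b ∈ B) (hl : b = lastNbr G w) :
    (linkUsers G B s(w, b)).card ≤ 1 ∧ (chainUsers G B s(w, b)).card = 0 ∧
    ((S.pointers.unpaired w).card = 2 → (linkUsers G B s(w, b)).card = 0) := by
  classical
  have hwB : w ∉ B := hw.1
  refine ⟨?_, ?_, fun h2 => ?_⟩
  · exact (Finset.card_le_card fun p hp => (S.linkUsers_cross hwB hb hp).1).trans
      (card_predecessor_le_one G w b)
  · refine Finset.card_eq_zero.mpr (Finset.eq_empty_of_forall_notMem fun p hp => ?_)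
    obtain ⟨h3, h4, h5⟩ := S.chainUsers_cross hwB hb hp
    rcases h5 with h5 | h5
    · rw [h5] at h4
      exact h4 hl
    · simp only [predecessor, Finset.mem_filter, mem_orientedEdges] at h5
      obtain ⟨⟨h6, -⟩, -, h7, -⟩ := h5
      rw [h7] at h4 h6
      exact h4 (hw.2 _ h3 _ (S.last_mem hwB) h6.symm (S.adj_last hwB))
  · refine Finset.card_eq_zero.mpr (Finset.eq_empty_of_forall_notMem fun p hp => ?_)
    obtain ⟨h3, h4⟩ := S.linkUsers_cross hwB hb hp
    simp only [predecessor, Finset.mem_filter, mem_orientedEdges] at h3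
    obtain ⟨⟨h5, h6⟩, -, h7, -⟩ := h3
    rw [h7] at h5 h6
    exact absurd (S.lt_of_unpaired w h2 p.1 ⟨h5.symm, hwB, h4⟩) (not_lt.mpr h6.le)

theorem orbitUsers_cross {w b : V} (hw : w ∉ B) (hb : b ∈ B) {q : V × V}
    (hq : q ∈ S.orbitUsers s(w, b)) :
    S.pointers.ptr q.1 = some q.2 ∧ q.1 ≤ S.pointers.swap q.1 ∧ b = lastNbr G w ∧
      (w = q.1 ∨ w = S.partner q) := by
  obtain ⟨⟨h1, h2⟩, h3⟩ := S.mem_orbitUsers.mp hq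
  have n1 := S.notMem_of_ptr h1
  have n2 := S.target_notMem h1
  have n3 := S.notMem_of_ptr (S.swap_ptr h1)
  have none_mem : ∀ x ∉ B, ∀ y ∉ B, (s(w, b) : Sym2 V) ≠ s(x, y) := by
    intro x hx y hy h
    rcases Sym2.eq_iff.mp h with h | h
    · exact hy (h.2 ▸ hb)
    · exact hx (h.2 ▸ hb)
  refine ⟨h1, h2, ?_⟩
  rcases h3 with (h3 | h3) | (h3 | h3) | h3
  · obtain ⟨h4, h5⟩ := mk_eq_of_mem hw (S.last_mem n1) h3
    exact ⟨by rw [h4, h5], Or.inl h4⟩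
  · obtain ⟨h4, h5⟩ := mk_eq_of_mem hw (S.last_mem (S.partner_notMem h1)) h3
    exact ⟨by rw [h5, ← h4], Or.inr h4⟩
  · exact absurd h3 (none_mem _ n1 _ n2)
  · exact absurd h3 (none_mem _ n3 _ n2)
  · exact absurd h3.1 (none_mem _ n1 _ n3)

theorem orbit_ext {q q' : V × V} (h : S.pointers.ptr q.1 = some q.2)
    (h' : S.pointers.ptr q'.1 = some q'.2) (hle : q.1 ≤ S.pointers.swap q.1)
    (hle' : q'.1 ≤ S.pointers.swap q'.1)
    (heq : q.1 = q'.1 ∨ q.1 = S.pointers.swap q'.1) : q = q' := by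
  have h1 : q.1 = q'.1 := by
    rcases heq with heq | heq
    · exact heq
    · rw [heq, S.pointers.swap_swap] at hle
      rw [heq]
      exact le_antisymm hle hle'
  refine Prod.ext h1 ?_
  rw [h1, h', Option.some_inj] at h
  exact h.symm

theorem card_orbitUsers_pointer {w b : V} (hw : IsPrivate G B w) (hb : b ∈ B)
    (hptr : S.pointers.ptr w ≠ none) : (S.orbitUsers s(w, b)).card ≤ 1 := by
  have hwB : w ∉ B := hw.1
  have hun : S.pointers.unpaired w = ∅ := Finset.card_eq_zero.mp (S.unpaired_eq_zero w hw hptr)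
  have key : ∀ q ∈ S.orbitUsers s(w, b), w = q.1 ∨ w = S.pointers.swap q.1 := by
    intro q hq
    obtain ⟨h1, -, -, h3⟩ := S.orbitUsers_cross hwB hb hq
    rcases h3 with h3 | h3
    · exact Or.inl h3
    · rw [partner] at h3
      split_ifs at h3 with h4
      · have : q.1 ∈ S.pointers.unpaired w :=
          PairedPointers.mem_unpaired.mpr ⟨by rw [h3]; exact h1, h4⟩
        simp [hun] at this
      · exact Or.inr h3
  refine Finset.card_le_one.mpr fun q hq q' hq' => ?_
  obtain ⟨h1, h2, -⟩ := S.orbitUsers_cross hwB hb hq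
  obtain ⟨h1', h2', -⟩ := S.orbitUsers_cross hwB hb hq'
  refine S.orbit_ext h1 h1' h2 h2' ?_
  rcases key q hq with h | h <;> rcases key q' hq' with h' | h'
  · exact Or.inl (h.symm.trans h')
  · exact Or.inr (h.symm.trans h')
  · refine Or.inr ?_
    rw [← h', h, S.pointers.swap_swap]
  · refine Or.inl ?_
    rw [← S.pointers.swap_swap q.1, ← h, h', S.pointers.swap_swap]

theorem card_orbitUsers_center {w b : V} (hw : w ∉ B) (hb : b ∈ B)
    (hptr : S.pointers.ptr w = none) :
    (S.orbitUsers s(w, b)).card ≤ (S.pointers.unpaired w).card := by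
  classical
  have key : ∀ q ∈ S.orbitUsers s(w, b), w = q.2 ∧ q.1 ∈ S.pointers.unpaired w := by
    intro q hq
    obtain ⟨h1, -, -, h3⟩ := S.orbitUsers_cross hw hb hq
    rcases h3 with h3 | h3
    · rw [h3, h1] at hptr
      simp at hptr
    · rw [partner] at h3
      split_ifs at h3 with h4
      · exact ⟨h3, PairedPointers.mem_unpaired.mpr ⟨by rw [h3]; exact h1, h4⟩⟩
      · rw [h3, S.swap_ptr h1] at hptr
        simp at hptr
  refine Finset.card_le_card_of_injOn Prod.fst (fun q hq => (key q hq).2) fun q hq q' hq' h => ?_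
  exact Prod.ext h ((key q hq).1.symm.trans (key q' hq').1)

theorem usage_cross {w b : V} (hw : w ∉ B) (hb : b ∈ B) :
    (linkUsers G B s(w, b)).card
      + 2 * ((chainUsers G B s(w, b)).card + (S.orbitUsers s(w, b)).card) ≤ 4 := by
  obtain ⟨h1, h2⟩ := S.card_star_cross hw hb
  by_cases hl : b = lastNbr G w
  · have h2 := h2 hl
    by_cases hpriv : IsPrivate G B w
    · obtain ⟨h3, h4, h5⟩ := S.card_star_private hpriv hb hl
      by_cases hptr : S.pointers.ptr w = none
      · have h6 := S.card_orbitUsers_center hw hb hptr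
        have h7 := S.unpaired_le_two w
        by_cases h8 : (S.pointers.unpaired w).card = 2
        · have := h5 h8
          omega
        · omega
      · have h6 := S.card_orbitUsers_pointer hpriv hb hptr
        omega
    · have hptr : S.pointers.ptr w = none := by
        by_contra hn
        obtain ⟨y, hy⟩ := Option.ne_none_iff_exists'.mp hn
        exact hpriv (S.isPrivate_of_ptr hy)
      have h3 := S.card_orbitUsers_center hw hb hptr
      have h4 := S.unpaired_le_one w hpriv
      omega
  · have h3 : S.orbitUsers s(w, b) = ∅ :=
      Finset.eq_empty_of_forall_notMem fun q hq => hl (S.orbitUsers_cross hw hb hq).2.2.1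
    rw [h3, Finset.card_empty]
    omega

/-- An edge outside `B` is used by at most one orbit, because it is either the edge along a pointer
or joins the two vertices of the orbit. -/
theorem card_orbitUsers_outside {x y : V} (hx : x ∉ B) (hy : y ∉ B) :
    (S.orbitUsers s(x, y)).card ≤ 1 := by
  set P := S.pointers with hP
  have key : ∀ q ∈ S.orbitUsers s(x, y), (P.ptr q.1 = some q.2 ∧ q.1 ≤ P.swap q.1) ∧
      ((∃ u, (u = q.1 ∨ u = P.swap q.1) ∧ P.ptr u = some q.2 ∧ s(x, y) = s(u, q.2)) ∨
        s(x, y) = s(q.1, P.swap q.1)) := by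
    intro q hq
    obtain ⟨h1, h3⟩ := S.mem_orbitUsers.mp hq
    refine ⟨h1, ?_⟩
    have none_mem : ∀ a, a ∉ B → (s(x, y) : Sym2 V) ≠ s(a, lastNbr G a) := by
      intro a ha h
      rcases Sym2.eq_iff.mp h with h | h
      · exact hy (h.2 ▸ S.last_mem ha)
      · exact hx (h.1 ▸ S.last_mem ha)
    rcases h3 with (h3 | h3) | (h3 | h3) | h3
    · exact absurd h3 (none_mem _ (S.notMem_of_ptr h1.1))
    · exact absurd h3 (none_mem _ (S.partner_notMem h1.1))
    · exact Or.inl ⟨q.1, Or.inl rfl, h1.1, h3⟩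
    · exact Or.inl ⟨P.swap q.1, Or.inr rfl, S.swap_ptr h1.1, h3⟩
    · exact Or.inr h3.1
  have mixed : ∀ u t w, P.ptr u = some t → (s(u, t) : Sym2 V) ≠ s(w, P.swap w) := by
    intro u t w hu h
    have hut : P.ptr u = P.ptr t := by
      rcases Sym2.eq_iff.mp h with ⟨h1, h2⟩ | ⟨h1, h2⟩
      · rw [h1, h2, P.ptr_swap]
      · rw [h1, h2, P.ptr_swap]
    rw [hu] at hut
    exact (P.adj t t hut.symm).1.ne rfl
  refine Finset.card_le_one.mpr fun q hq q' hq' => ?_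
  obtain ⟨⟨h1, h2⟩, h3⟩ := key q hq
  obtain ⟨⟨h1', h2'⟩, h3'⟩ := key q' hq'
  refine S.orbit_ext h1 h1' h2 h2' ?_
  rcases h3 with ⟨u, hu1, hu2, hu3⟩ | h3
  · rcases h3' with ⟨v, hv1, hv2, hv3⟩ | h3'
    · have huv : u = v := by
        rcases Sym2.eq_iff.mp (hu3.symm.trans hv3) with ⟨h, -⟩ | ⟨h, h'⟩
        · exact h
        · rw [← h] at hv2
          rw [h'] at hu2
          exact absurd hv2 (P.asymm u v hu2)
      subst huv
      rcases hu1 with h | h <;> rcases hv1 with h' | h'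
      · exact Or.inl (h.symm.trans h')
      · exact Or.inr (h.symm.trans h')
      · refine Or.inr ?_
        rw [← hP, ← h', h, P.swap_swap]
      · refine Or.inl ?_
        rw [← P.swap_swap q.1, ← h, h', P.swap_swap]
    · exact absurd (hu3.symm.trans h3') (mixed u q.2 q'.1 hu2)
  · rcases h3' with ⟨v, hv1, hv2, hv3⟩ | h3'
    · exact absurd (hv3.symm.trans h3) (mixed v q'.2 q.1 hv2)
    · rcases Sym2.eq_iff.mp (h3.symm.trans h3') with ⟨h, -⟩ | ⟨h, -⟩
      · exact Or.inl h
      · exact Or.inr h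

theorem usage_outside {x y : V} (hx : x ∉ B) (hy : y ∉ B) (hxy : x < y) :
    (linkUsers G B s(x, y)).card
      + 2 * ((chainUsers G B s(x, y)).card + (S.orbitUsers s(x, y)).card) ≤ 4 := by
  classical
  have h1 : (linkUsers G B s(x, y)).card ≤ 2 := by
    have := card_predecessor_le_one G x y
    refine ((Finset.card_le_card fun p hp => ?_).trans
      (Finset.card_insert_le (y, x) (predecessor G x y))).trans (by omega)
    simp only [linkUsers, Finset.mem_filter] at hp
    obtain ⟨hp1, hp2, hp3⟩ := hp
    have hl := S.ne_last (S.low_notMem hp1) hp2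
    rcases eq_or_next_of_chainUses hxy hp1 hl hp3 with h | h
    · exact Finset.mem_insert.mpr (Or.inl h)
    · exact Finset.mem_insert.mpr (Or.inr (by
        simp only [predecessor, Finset.mem_filter]; exact ⟨hp1, hl, h⟩))
  have h2 : chainUsers G B s(x, y) = ∅ := by
    refine Finset.eq_empty_of_forall_notMem fun p hp => ?_
    simp only [chainUsers, Finset.mem_filter] at hp
    obtain ⟨hp1, ⟨hp2, hl⟩, hp3⟩ := hp
    rcases eq_or_next_of_chainUses hxy hp1 hl hp3 with h | h
    · rw [h] at hp2
      exact hy hp2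
    · refine hy (h.2 ▸ S.mem_of_le hp2 ?_)
      exact (nextNbr_spec (mem_orientedEdges.mp hp1).1.symm hl).1.2.le
  have h3 := S.card_orbitUsers_outside hx hy
  rw [h2, Finset.card_empty]
  omega

theorem usage_le (e : Sym2 V) :
    (linkUsers G B e).card + 2 * ((chainUsers G B e).card + (S.orbitUsers e).card) ≤ 4 := by
  classical
  by_cases he : e ∈ G.edgeSet
  · have main : ∀ x y, G.Adj x y → x < y → (linkUsers G B s(x, y)).card
        + 2 * ((chainUsers G B s(x, y)).card + (S.orbitUsers s(x, y)).card) ≤ 4 := by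
      intro x y hxy hlt
      by_cases hx : x ∈ B
      · exact absurd hxy (S.indep x hx y (S.mem_of_le hx hlt.le))
      · by_cases hy : y ∈ B
        · exact S.usage_cross hx hy
        · exact S.usage_outside hx hy hlt
    induction e with | h x y =>
    rw [SimpleGraph.mem_edgeSet] at he
    rcases lt_or_gt_of_ne he.ne with h | h
    · exact main x y he h
    · rw [Sym2.eq_swap]
      exact main y x he.symm h
  · have hadj : ∀ x y, G.Adj x y → e ≠ s(x, y) := fun x y h h' => he (by rw [h']; exact h)
    have hchain : ∀ p ∈ orientedEdges G, p.1 ≠ lastNbr G p.2 → ¬ chainUses G p e := by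
      intro p hp hl h
      obtain ⟨h1, -⟩ := mem_orientedEdges.mp hp
      rcases h with h | h
      · exact hadj _ _ h1.symm h
      · exact hadj _ _ (nextNbr_spec h1.symm hl).1.1 h
    have h1 : linkUsers G B e = ∅ := by
      refine Finset.eq_empty_of_forall_notMem fun p hp => ?_
      simp only [linkUsers, Finset.mem_filter] at hp
      exact hchain p hp.1 (S.ne_last (S.low_notMem hp.1) hp.2.1) hp.2.2
    have h2 : chainUsers G B e = ∅ := by
      refine Finset.eq_empty_of_forall_notMem fun p hp => ?_
      simp only [chainUsers, Finset.mem_filter] at hp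
      exact hchain p hp.1 hp.2.1.2 hp.2.2
    have h3 : S.orbitUsers e = ∅ := by
      refine Finset.eq_empty_of_forall_notMem fun q hq => ?_
      obtain ⟨⟨h1, -⟩, h3⟩ := S.mem_orbitUsers.mp hq
      rcases h3 with (h3 | h3) | (h3 | h3) | h3
      · exact hadj _ _ (S.adj_last (S.notMem_of_ptr h1)) h3
      · exact hadj _ _ (S.adj_last (S.partner_notMem h1)) h3
      · exact hadj _ _ (S.adj_of_ptr h1) h3
      · exact hadj _ _ (S.adj_of_ptr (S.swap_ptr h1)) h3
      · exact hadj _ _ h3.2 h3.1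
    simp [h1, h2, h3]

end Layout

end LayoutTokens

/-! ### Every edge to `B` is covered by a form -/

section Cover

variable {V : Type*} [Fintype V] [LinearOrder V]

namespace Layout

variable {G : SimpleGraph V} {B : Set V} (S : Layout G B)

/-- The two vertices of `B` in the image of a form. -/
noncomputable def label : (ChainIndex G B ⊕ S.OrbitIndex) × Bool → V
  | (Sum.inl p, false) => p.1.1
  | (Sum.inl p, true) => nextNbr G p.1.2 p.1.1
  | (Sum.inr q, false) => lastNbr G q.1.1
  | (Sum.inr q, true) => lastNbr G (S.partner q.1)

/-- The vertices outside `B` to which the two ends of a form are ascribed. -/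
noncomputable def owner : (ChainIndex G B ⊕ S.OrbitIndex) × Bool → V
  | (Sum.inl p, _) => p.1.2
  | (Sum.inr q, false) => q.1.1
  | (Sum.inr q, true) => S.partner q.1

/-- A vertex `w` with several neighbours in `B` covers its edges by its chain, since every neighbour
is the first or the second one of a pair of consecutive neighbours; a private vertex covers its only
edge to `B` by the orbit of its pointer, or by an unpaired pointer to it. -/
theorem exists_label_eq {b w : V} (hb : b ∈ B) (hbw : G.Adj b w) :
    ∃ i, S.label i = b ∧ S.owner i = w := by
  classical
  have hw : w ∉ B := fun h => S.indep b hb w h hbw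
  have hlt := S.lt_of_mem w hw b hb
  by_cases hpriv : IsPrivate G B w
  · have hl : lastNbr G w = b := hpriv.2 _ (S.last_mem hw) b hb (S.adj_last hw) hbw.symm
    by_cases hptr : S.pointers.ptr w = none
    · obtain ⟨u, hu⟩ := S.unpaired_nonempty w hpriv hptr
      obtain ⟨h1, h2⟩ := PairedPointers.mem_unpaired.mp hu
      have hp : S.partner (u, w) = w := by rw [partner, if_pos h2]
      refine ⟨(Sum.inr ⟨(u, w), h1, by rw [h2]⟩, true), ?_, hp⟩
      change lastNbr G (S.partner (u, w)) = b
      rw [hp, hl]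
    · obtain ⟨y, hy⟩ := Option.ne_none_iff_exists'.mp hptr
      by_cases hle : w ≤ S.pointers.swap w
      · exact ⟨(Sum.inr ⟨(w, y), hy, hle⟩, false), hl, rfl⟩
      · have hne : S.pointers.swap (S.pointers.swap w) ≠ S.pointers.swap w := by
          rw [S.pointers.swap_swap]
          exact fun h => hle h.le
        have hp : S.partner (S.pointers.swap w, y) = w := by
          rw [partner, if_neg hne, S.pointers.swap_swap]
        refine ⟨(Sum.inr ⟨(S.pointers.swap w, y), S.swap_ptr hy, ?_⟩, true), ?_, hp⟩
        · rw [S.pointers.swap_swap]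
          exact (not_le.mp hle).le
        · change lastNbr G (S.partner (S.pointers.swap w, y)) = b
          rw [hp, hl]
  · by_cases hl : b = lastNbr G w
    · obtain ⟨c, hc, hbc⟩ : ∃ c ∈ B, G.Adj w c ∧ c < b := by
        by_contra! hn
        have hle : ∀ c ∈ B, G.Adj w c → c = b := fun c hc hwc =>
          le_antisymm (hl ▸ (lastNbr_spec hwc).2 c hwc) (hn c hc hwc)
        exact hpriv ⟨hw, fun x hx y hy hwx hwy => (hle x hx hwx).trans (hle y hy hwy).symm⟩
      -- the last neighbour of `w` before `b`
      obtain ⟨m, hm, hmax⟩ := Finset.exists_max_image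
        (Finset.univ.filter fun u => G.Adj w u ∧ u < b) id ⟨c, by simpa using hbc⟩
      simp only [Finset.mem_filter, Finset.mem_univ, true_and, id] at hm hmax
      have hmB : m ∈ B := S.mem_of_le hc (hmax c hbc)
      have hml : m ≠ lastNbr G w := fun h => hm.2.ne (h.trans hl.symm)
      obtain ⟨⟨h1, h2⟩, h3⟩ := nextNbr_spec hm.1 hml
      refine ⟨(Sum.inl ⟨(m, w), mem_orientedEdges.mpr ⟨hm.1.symm, S.lt_of_mem w hw m hmB⟩, hmB,
        hml⟩, true), ?_, rfl⟩
      change nextNbr G w m = b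
      refine le_antisymm (h3 b hbw.symm hm.2) (not_lt.mp fun h => ?_)
      exact absurd (hmax _ ⟨h1, h⟩) (not_le.mpr h2)
    · exact ⟨(Sum.inl ⟨(b, w), mem_orientedEdges.mpr ⟨hbw, hlt⟩, hb, hl⟩, false), rfl, rfl⟩

theorem exists_coeff_ne_zero (S : Layout G B) : ∃ K : Sym2 V →₀ ℕ,
    coeff K (∏ p ∈ orientedEdges G, (starSum G p.1 - starSum G p.2)) ≠ 0 ∧ ∀ e, K e ≤ 4 := by
  classical
  have next : ∀ p ∈ orientedEdges G, p.1 ≠ lastNbr G p.2 →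
      G.Adj p.2 (nextNbr G p.2 p.1) ∧ p.1 < nextNbr G p.2 p.1 := fun p hp hl =>
    (nextNbr_spec (mem_orientedEdges.mp hp).1.symm hl).1
  have link : ∀ p ∈ orientedEdges G, p.1 ∉ B → p.1 ≠ lastNbr G p.2 := fun p hp h =>
    S.ne_last (S.low_notMem hp) h
  refine Tokens.exists_coeff_ne_zero (B := B) (J := ChainIndex G B ⊕ S.OrbitIndex)
    { lt_of_mem := S.lt_of_mem
      indep := S.indep
      succ := fun p => nextNbr G p.2 p.1
      lt_succ := fun p hp h => (next p hp (link p hp h)).2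
      adj_succ := fun p hp h => (next p hp (link p hp h)).1
      form := Sum.elim (fun p => X s(p.1.2, p.1.1) - X s(p.1.2, nextNbr G p.1.2 p.1.1))
        (fun q => S.orbitForm q.1)
      label := S.label
      sign := Sum.elim (fun _ => -1) (fun q => S.orbitSign q.1)
      label_mem := ?_
      sign_sq := ?_
      sign_eq := ?_
      aeval_form := ?_
      owner := S.owner
      cover := fun b hb w h => S.exists_label_eq hb h
      uses := Sum.elim (fun p => chainUses G p.1) (fun q => S.orbitUses q.1)
      degreeOf_le := ?_
      usage_le := ?_ }
  · rintro ⟨p | q, _ | _⟩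
    · exact p.2.2.1
    · exact S.mem_of_le p.2.2.1 (next p.1 p.2.1 p.2.2.2).2.le
    · exact S.last_mem (S.notMem_of_ptr q.2.1)
    · exact S.last_mem (S.partner_notMem q.2.1)
  · rintro (p | q)
    · rfl
    · rw [Sum.elim_inr, orbitSign]
      split_ifs <;> rfl
  · rintro (p | q) h
    · exact absurd h (next p.1 p.2.1 p.2.2.2).2.ne
    · exact S.orbitSign_eq q.2.1 h
  · rintro (p | q)
    · rw [Sum.elim_inl, Sum.elim_inl, map_sub, aeval_X, aeval_X,
        endSum_mk (mem_orientedEdges.mp p.2.1).1.symm, endSum_mk (next p.1 p.2.1 p.2.2.2).1]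
      simp only [label, map_neg, C_1]
      ring
    · exact S.aeval_orbitForm q.2.1
  · rintro (p | q) e
    · refine degreeOf_sub_le_of_le (degreeOf_X_le ?_) (degreeOf_X_le ?_)
      · exact Or.inl
      · exact Or.inr
    · exact S.degreeOf_orbitForm q.1 e
  · intro e
    refine le_trans ?_ (S.usage_le e)
    refine add_le_add (Finset.card_le_card fun p hp => ?_) (Nat.mul_le_mul_left 2 ?_)
    · exact Finset.mem_filter.mpr (Finset.mem_filter.mp hp)
    · rw [Finset.card_filter, Fintype.sum_sum_type]
      refine add_le_add ?_ ?_
      · rw [← Finset.card_filter]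
        refine Finset.card_le_card_of_injOn Subtype.val (fun p hp => ?_)
          Subtype.val_injective.injOn
        exact Finset.mem_filter.mpr ⟨p.2.1, p.2.2, (Finset.mem_filter.mp hp).2⟩
      · rw [← Finset.card_filter]
        refine Finset.card_le_card_of_injOn Subtype.val (fun q hq => ?_)
          Subtype.val_injective.injOn
        exact S.mem_orbitUsers.mpr ⟨q.2, (Finset.mem_filter.mp hq).2⟩

end Layout

end Cover

/-! ### Finite graphs -/

/-- Finite graphs without isolated edges can be weighted from lists of five integers, for arbitrary
fixed vertex weights `c`. -/
theorem exists_weights_finite {V : Type*} [Fintype V] (G : SimpleGraph V)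
    (hG : ∀ u v, G.Adj u v → (∃ x, x ≠ v ∧ G.Adj u x) ∨ ∃ x, x ≠ u ∧ G.Adj v x)
    (c : V → ℤ) (L : Sym2 V → Finset ℤ) (hL : ∀ e, 5 ≤ (L e).card) :
    ∃ ω : Sym2 V → ℤ, (∀ e, ω e ∈ L e) ∧ ∀ u v, G.Adj u v → open Classical in
      (∑ w, if G.Adj u w then ω s(u, w) else 0) + c u
        ≠ (∑ w, if G.Adj v w then ω s(v, w) else 0) + c v := by
  classical
  obtain ⟨B, hind, hdom, hpriv, hadj⟩ := exists_dominating_indep G hG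
  obtain ⟨P, h1, h2, h3, h4, h5⟩ := exists_pairedPointers (outside G B) (IsPrivate G B) hpriv
  -- order the vertices: first those outside `B` with at most one unpaired pointer, then those with
  -- two, then `B`
  set rank : V → ℕ := fun v => if v ∈ B then 2 else if (P.unpaired v).card = 2 then 1 else 0
    with hrank
  let _ : LinearOrder V := LinearOrder.lift'
    (fun v => (toLex (rank v, Fintype.equivFin V v) : ℕ ×ₗ Fin (Fintype.card V)))
    (fun u v h => (Fintype.equivFin V).injective (congrArg (fun x => (ofLex x).2) h))
  have hlt : ∀ u v : V, rank u < rank v → u < v := fun u v h =>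
    show (toLex (rank u, Fintype.equivFin V u) : ℕ ×ₗ Fin (Fintype.card V))
      < toLex (rank v, Fintype.equivFin V v) from Prod.Lex.toLex_lt_toLex.mpr (Or.inl h)
  have S : Layout G B :=
    { indep := hind
      dom := hdom
      adj_of_private := hadj
      lt_of_mem := fun a ha b hb => hlt a b (by
        simp only [hrank, ha, hb, if_true, if_false]
        split_ifs <;> omega)
      pointers := P
      unpaired_eq_zero := h1
      unpaired_nonempty := h2
      unpaired_le_two := h3
      unpaired_le_one := h4
      lt_of_unpaired := fun y hy v hv => hlt v y (by
        have hv2 : (P.unpaired v).card ≠ 2 := fun h => h5 y v hy h hv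
        have h1 := hv.2.1
        have h2 := hv.2.2
        simp [hrank, hy, h1, h2, hv2]) }
  obtain ⟨K, hK, hK4⟩ := S.exists_coeff_ne_zero
  obtain ⟨ω, hω, h⟩ := exists_weights_of_coeff_ne_zero G hK hK4 c L hL
  refine ⟨ω, hω, fun u v huv => ?_⟩
  have := h u v huv
  rwa [eval_starSum, eval_starSum] at this

universe u

/-! ### Weighted degrees in infinite graphs -/

section Infinite

open Cardinal

theorem sum_natCast_eq {ι : Type u} [Fintype ι] (n : ι → ℕ) :
    Cardinal.sum (fun i => (n i : Cardinal.{u})) = ((∑ i, n i : ℕ) : Cardinal.{u}) := by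
  have h : ∀ i, (n i : Cardinal.{u}) = #(ULift.{u} (Fin (n i))) := fun i => by simp
  simp only [h]
  rw [← mk_sigma, mk_fintype, Fintype.card_sigma]
  simp

variable {V : Type u} {G : SimpleGraph V}

theorem weightedDegree_of_finite (ω : Weighting G) (v : V) [Fintype (G.neighborSet v)] :
    ω.weightedDegree v
      = ((∑ w : G.neighborSet v, ω.edge ⟨s(v, (w : V)), w.2⟩ + ω.vert v : ℕ) : Cardinal.{u}) := by
  rw [Weighting.weightedDegree, sum_natCast_eq, Nat.cast_add]

theorem weightedDegree_of_infinite {k : ℕ} {L : Lists G k} {ω : Weighting G} (hω : ω.IsFrom L)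
    {v : V} (hv : ℵ₀ ≤ degree G v) : ω.weightedDegree v = degree G v := by
  have hmem : ∀ e, 1 ≤ ω.edge e ∧ ω.edge e ≤ k := fun e =>
    Finset.mem_Icc.mp (L.edge_subset e (hω.2 e))
  have hsum : Cardinal.sum (fun w : G.neighborSet v =>
      (ω.edge ⟨s(v, (w : V)), w.2⟩ : Cardinal.{u})) = degree G v := by
    refine le_antisymm ?_ ?_
    · refine (sum_le_sum _ (fun _ => ℵ₀) fun w => (natCast_lt_aleph0).le).trans ?_
      rw [sum_const']
      exact (mul_aleph0_eq hv).le
    · refine le_trans ?_ (sum_le_sum (fun _ : G.neighborSet v => (1 : Cardinal.{u})) _ fun w => ?_)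
      · rw [sum_const', mul_one, degree]
      · exact_mod_cast (hmem _).1
  rw [Weighting.weightedDegree, hsum, add_nat_eq _ hv]

/-! ### Compactness -/

/-- Any finite set of edges between vertices of finite degree can be satisfied: apply the finite
case to the edges that meet one of their endvertices. -/
theorem exists_weights_of_finset {k : ℕ} (hG : ¬ ∃ e : Sym2 V, IsIsolatedEdge G e)
    (L : Lists G k) (hE : ∀ e : G.edgeSet, 5 ≤ (L.edge e).card) (c : V → ℕ)
    (F : Finset G.edgeSet) :
    ∃ x : (e : G.edgeSet) → L.edge e, ∀ u v (huv : G.Adj u v),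
      ⟨s(u, v), huv⟩ ∈ F → ∀ [Fintype (G.neighborSet u)] [Fintype (G.neighborSet v)],
      ∑ w : G.neighborSet u, (x ⟨s(u, (w : V)), w.2⟩ : ℕ) + c u
        ≠ ∑ w : G.neighborSet v, (x ⟨s(v, (w : V)), w.2⟩ : ℕ) + c v := by
  classical
  have mk_swap : ∀ {a b : V} (h : G.Adj a b),
      (⟨s(a, b), h⟩ : G.edgeSet) = ⟨s(b, a), h.symm⟩ := fun _ => Subtype.ext Sym2.eq_swap
  -- the endvertices in question, and with them all their neighbours
  set U : Set V := {u | (G.neighborSet u).Finite ∧ ∃ v, ∃ h : G.Adj u v,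
    ⟨s(u, v), h⟩ ∈ F ∧ (G.neighborSet v).Finite} with hU
  have hUfin : U.Finite := by
    refine Set.Finite.subset (s := ⋃ e ∈ F, {v | v ∈ (e : Sym2 V)}) ?_ ?_
    · refine Set.Finite.biUnion F.finite_toSet fun e _ => ?_
      induction (e : Sym2 V) with | h a b =>
      refine Set.Finite.subset (Set.toFinite {a, b}) fun v hv => ?_
      simpa using hv
    · rintro u ⟨-, v, h, hF, -⟩
      simp only [Set.mem_iUnion]
      exact ⟨_, hF, by simp⟩
  set W : Set V := U ∪ ⋃ u ∈ U, G.neighborSet u with hW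
  have hWfin : W.Finite := hUfin.union (hUfin.biUnion fun u hu => hu.1)
  have hWnbr : ∀ u ∈ U, ∀ v, G.Adj u v → v ∈ W := fun u hu v h =>
    Or.inr (Set.mem_biUnion hu h)
  have := hWfin.fintype
  set H : SimpleGraph W :=
    { Adj := fun a b => G.Adj a b ∧ ((a : V) ∈ U ∨ (b : V) ∈ U)
      symm := ⟨fun a b h => ⟨h.1.symm, h.2.symm⟩⟩
      loopless := ⟨fun a h => h.1.ne rfl⟩ } with hH
  have hnbr : ∀ a b : W, H.Adj a b → (a : V) ∈ U →
      (∃ x, x ≠ b ∧ H.Adj a x) ∨ ∃ x, x ≠ a ∧ H.Adj b x := by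
    intro a b hab ha
    obtain ⟨-, a', haa', hF, ha'⟩ := id ha
    have ha'U : a' ∈ U := ⟨ha', a, haa'.symm, mk_swap haa' ▸ hF, ha.1⟩
    by_cases hb : (b : V) = a'
    · -- both ends belong to `U`, so all edges of `G` at them are present
      by_contra! hn
      refine hG ⟨s((a : V), (b : V)), hab.1, fun f hf hne v hv hvf => hne ?_⟩
      obtain ⟨y, rfl⟩ := hvf
      rw [SimpleGraph.mem_edgeSet] at hf
      rcases Sym2.mem_iff.mp hv with rfl | rfl
      · by_contra hne'
        exact hn.1 ⟨y, hWnbr _ ha y hf⟩ (fun h => hne' (by rw [← h])) ⟨hf, Or.inl ha⟩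
      · have hbU : (b : V) ∈ U := hb ▸ ha'U
        by_contra hne'
        exact hn.2 ⟨y, hWnbr _ hbU y hf⟩ (fun h => hne' (by rw [← h]; exact Sym2.eq_swap))
          ⟨hf, Or.inl hbU⟩
    · exact Or.inl ⟨⟨a', Or.inl ha'U⟩, fun h => hb (by rw [← h]), haa', Or.inl ha⟩
  have hHiso : ∀ a b : W, H.Adj a b →
      (∃ x, x ≠ b ∧ H.Adj a x) ∨ ∃ x, x ≠ a ∧ H.Adj b x := by
    intro a b hab
    rcases hab.2 with ha | hb
    · exact hnbr a b hab ha
    · exact (hnbr b a hab.symm hb).symm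
  -- lists for the pairs in `W`; those of the pairs that are no edges do not matter
  set L' : Sym2 W → Finset ℤ := fun e =>
    if h : e.map Subtype.val ∈ G.edgeSet then (L.edge ⟨_, h⟩).image (Nat.cast : ℕ → ℤ)
    else (Finset.range 5).image (Nat.cast : ℕ → ℤ) with hL'
  have hL'card : ∀ e, 5 ≤ (L' e).card := by
    intro e
    simp only [hL']
    split_ifs with h
    · rw [Finset.card_image_of_injective _ Nat.cast_injective]
      exact hE _
    · rw [Finset.card_image_of_injective _ Nat.cast_injective, Finset.card_range]
  obtain ⟨ω, hω, hne⟩ := exists_weights_finite H hHiso (fun v => (c v : ℤ)) L' hL'card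
  have hx : ∀ e : G.edgeSet, ∃ n : L.edge e, ∀ e' : Sym2 W, e'.map Subtype.val = e →
      ((n : ℕ) : ℤ) = ω e' := by
    intro e
    by_cases h : ∃ e' : Sym2 W, e'.map Subtype.val = e
    · obtain ⟨e', he'⟩ := h
      have h1 := hω e'
      have he : e'.map Subtype.val ∈ G.edgeSet := he' ▸ e.2
      simp only [hL', he, dif_pos] at h1
      obtain ⟨n, hn, hn'⟩ := Finset.mem_image.mp h1
      have heq : (⟨_, he⟩ : G.edgeSet) = e := Subtype.ext he'
      rw [heq] at hn
      refine ⟨⟨n, hn⟩, fun e'' he'' => ?_⟩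
      rw [Sym2.map.injective Subtype.val_injective (he''.trans he'.symm)]
      exact hn'
    · have h5 := hE e
      obtain ⟨n, hn⟩ := Finset.card_pos.mp (show 0 < (L.edge e).card by omega)
      exact ⟨⟨n, hn⟩, fun e' he' => absurd ⟨e', he'⟩ h⟩
  choose x hx using hx
  have hsum : ∀ (u : W) [Fintype (G.neighborSet (u : V))], (u : V) ∈ U →
      (∑ w : W, if H.Adj u w then ω s(u, w) else 0)
        = ((∑ w : G.neighborSet (u : V), (x ⟨s((u : V), (w : V)), w.2⟩ : ℕ) : ℕ) : ℤ) := by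
    intro u _ hu
    rw [← Finset.sum_filter, Nat.cast_sum]
    refine Finset.sum_bij (fun w hw => ⟨(w : V), ((Finset.mem_filter.mp hw).2).1⟩)
      (fun _ _ => Finset.mem_univ _) (fun a _ b _ h => ?_) (fun w _ => ?_) (fun w hw => ?_)
    · exact Subtype.ext (Subtype.mk.inj h)
    · exact ⟨⟨w, hWnbr _ hu _ w.2⟩,
        Finset.mem_filter.mpr ⟨Finset.mem_univ _, w.2, Or.inl hu⟩, rfl⟩
    · exact (hx _ _ (by simp)).symm
  refine ⟨x, fun u v huv hF _ _ => ?_⟩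
  have hu : u ∈ U := ⟨Set.toFinite _, v, huv, hF, Set.toFinite _⟩
  have hv : v ∈ U :=
    ⟨Set.toFinite _, u, huv.symm, mk_swap huv ▸ hF, Set.toFinite _⟩
  have hfinal := hne ⟨u, Or.inl hu⟩ ⟨v, Or.inl hv⟩ ⟨huv, Or.inl hu⟩
  intro heq
  apply hfinal
  have h1 := hsum ⟨u, Or.inl hu⟩ hu
  have h2 := hsum ⟨v, Or.inl hv⟩ hv
  have heq' := congrArg (Nat.cast : ℕ → ℤ) heq
  rw [Nat.cast_add, Nat.cast_add] at heq'
  convert heq' using 2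
  · convert h1
  · convert h2

/-- By compactness of the product of the finite lists, all edges between vertices of finite degree
can be satisfied at once. -/
theorem exists_weights_of_finite_degree {k : ℕ} (hG : ¬ ∃ e : Sym2 V, IsIsolatedEdge G e)
    (L : Lists G k) (hE : ∀ e : G.edgeSet, 5 ≤ (L.edge e).card) (c : V → ℕ) :
    ∃ x : (e : G.edgeSet) → L.edge e, ∀ u v, G.Adj u v →
      ∀ [Fintype (G.neighborSet u)] [Fintype (G.neighborSet v)],
      ∑ w : G.neighborSet u, (x ⟨s(u, (w : V)), w.2⟩ : ℕ) + c u
        ≠ ∑ w : G.neighborSet v, (x ⟨s(v, (w : V)), w.2⟩ : ℕ) + c v := by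
  classical
  choose g hg using exists_weights_of_finset hG L hE c
  obtain ⟨χ, hχ⟩ := Finset.rado_selection (β := fun e : G.edgeSet => L.edge e) g
  refine ⟨χ, fun u v huv _ _ => ?_⟩
  set star : ∀ a [Fintype (G.neighborSet a)], Finset G.edgeSet := fun a _ =>
    Finset.univ.image fun w : G.neighborSet a => ⟨s(a, (w : V)), w.2⟩ with hstar
  obtain ⟨t, hst, ht⟩ := hχ (star u ∪ star v)
  have hmem : ∀ (a : V) [Fintype (G.neighborSet a)] (w : G.neighborSet a),
      (⟨s(a, (w : V)), w.2⟩ : G.edgeSet) ∈ star a := fun a _ w =>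
    Finset.mem_image.mpr ⟨w, Finset.mem_univ _, rfl⟩
  have h := hg t u v huv (hst (Finset.mem_union_left _ (hmem u ⟨v, huv⟩)))
  rw [Finset.sum_congr rfl fun w _ => by rw [ht _ (Finset.mem_union_left _ (hmem u w))],
    Finset.sum_congr (s₂ := (Finset.univ : Finset (G.neighborSet v))) rfl fun w _ => by
      rw [ht _ (Finset.mem_union_right _ (hmem v w))]]
  exact h

end Infinite

end TotalWeighting

theorem theorem3 {V : Type*} (G : SimpleGraph V)
    (hG : ¬ ∃ e : Sym2 V, TotalWeighting.IsIsolatedEdge G e)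
    (k : ℕ) (L : TotalWeighting.Lists G k)
    (hV : ∀ v : V, (L.vert v).card = 1)
    (hE : ∀ e : G.edgeSet, 5 ≤ (L.edge e).card) :
    TotalWeighting.HasWeighting G L := by
  classical
  choose c hc using fun v => Finset.card_pos.mp (show 0 < (L.vert v).card by rw [hV v]; exact one_pos)
  obtain ⟨x, hx⟩ := TotalWeighting.exists_weights_of_finite_degree hG L hE c
  set ω : TotalWeighting.Weighting G := ⟨c, fun e => x e⟩ with hω
  have hfrom : ω.IsFrom L := ⟨hc, fun e => (x e).2⟩
  have hfin : ∀ a, ¬ Cardinal.aleph0 ≤ TotalWeighting.degree G a → Finite (G.neighborSet a) :=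
    fun a ha => Cardinal.lt_aleph0_iff_finite.mp (not_le.mp ha)
  refine ⟨ω, hfrom, fun u v huv => ?_⟩
  by_cases hu : Cardinal.aleph0 ≤ TotalWeighting.degree G u
  · rw [TotalWeighting.weightedDegree_of_infinite hfrom hu]
    by_cases hv : Cardinal.aleph0 ≤ TotalWeighting.degree G v
    · rw [TotalWeighting.weightedDegree_of_infinite hfrom hv]
      by_cases h : TotalWeighting.degree G u = TotalWeighting.degree G v
      · exact Or.inr ⟨h, hu⟩
      · exact Or.inl h
    · have := hfin v hv
      have := Fintype.ofFinite (G.neighborSet v)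
      rw [TotalWeighting.weightedDegree_of_finite]
      exact Or.inl (ne_of_gt (Cardinal.natCast_lt_aleph0.trans_le hu))
  · have := hfin u hu
    have := Fintype.ofFinite (G.neighborSet u)
    left
    rw [TotalWeighting.weightedDegree_of_finite]
    by_cases hv : Cardinal.aleph0 ≤ TotalWeighting.degree G v
    · rw [TotalWeighting.weightedDegree_of_infinite hfrom hv]
      exact ne_of_lt (Cardinal.natCast_lt_aleph0.trans_le hv)
    · have := hfin v hv
      have := Fintype.ofFinite (G.neighborSet v)
      rw [TotalWeighting.weightedDegree_of_finite]
      exact_mod_cast hx u v huv
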